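/- **Setting.** Let $H$ be a complex Hilbert space (inner products are conjugate linear in the first argument). For $\varrho\in\mathbb R$ let $H_{\varrho,0}$ be the Hilbert space of (classes of) measurable $f:\mathbb R\to H$ with $|f|_{\varrho,0}^2=\int_{\mathbb R}\|f(x)\|^2e^{-2\varrho x}\,dx<\infty$, and let $H_{\varrho,1}=\{f\in H_{\varrho,0}: f'\in H_{\varrho,0}\}$ ($f'$ the distributional derivative), with $\partial_{0,\varrho}f=f'$ and $|f|_{\varrho,1}=|\partial_{0,\varrho}f|_{\varrho,0}$. Let $H_{\varrho,-1}=(H_{-\varrho,1})^*$ be the space of continuous linear functionals on $H_{-\varrho,1}$ with the dual norm. For $\varrho>0$ the time derivative is the bijective isometry $$\partial_{0,\varrho}:H_{\varrho,0}\to H_{\varrho,-1},\qquad \partial_{0,\varrho}u:\ \psi\mapsto\int_{\mathbb R}\langle u(x),-\psi'(x)\rangle\,dx .$$ For $r>0$, a bounded analytic $M:B(r,r)\to L(H)$ on the disc $B(r,r)=\{z\in\mathbb C:|z-r|<r\}$ and $\varrho>\frac1{2r}$ put $M(\partial_{0,\varrho}^{-1})=\mathcal L_\varrho^{*}\,M\!\left(\tfrac1{it+\varrho}\right)\mathcal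 L_\varrho$ on $H_{\varrho,0}$, where $(\mathcal L_\varrho u)(t)=\frac1{\sqrt{2\pi}}\int_{\mathbb R}e^{-itx}e^{-\varrho x}u(x)\,dx$ is the unitary Fourier–Laplace transform from $H_{\varrho,0}$ onto $L^2(\mathbb R;H)$; on $H_{\varrho,-1}$ put $M(\partial_{0,\varrho}^{-1})=\partial_{0,\varrho}\,M(\partial_{0,\varrho}^{-1})\,\partial_{0,\varrho}^{-1}$. Let $C_c^\infty(\mathbb R;H)$ be the space of smooth compactly supported functions and $C_\infty^+(\mathbb R;H)$ the space of smooth $\psi:\mathbb R\to H$ with $\sup\operatorname{supp}\psi<\infty$ and $\psi^{(n)}\in C_c^\infty(\mathbb R;H)$ for some $n\in\mathbb N$; let $C_\infty^+(\mathbb R;H)'$ be the space of all linear functionals on it. A map $W:H_{\varrho,0}\to H_{\varrho,0}$ is *causal* if for all $a\in\mathbb R$ and all $x,y\in H_{\varrho,0}$: $x=y$ a.e. on $(-\infty,a)$ implies $W(x)=W(y)$ a.e. on $(-\infty,a)$. **Theorem 5.14.** Let $r>0$, let $M,N:B(r,r)\to L(H)$ be analytic and bounded, let $\varrho_0>0$,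 $s\in(0,1)$, and let $F:C_c^\infty(\mathbb R;H)\to C_\infty^+(\mathbb R;H)'$ be such that for every $\varrho>\varrho_0$ there is $K>0$ with $$|F(0)(\psi)|\le K|\psi|_{-\varrho,1},\qquad |F(u)(\psi)-F(w)(\psi)|\le s\,|\psi|_{-\varrho,1}\,|u-w|_{\varrho,0}$$ for all $u,w\in C_c^\infty(\mathbb R;H)$, $\psi\in C_\infty^+(\mathbb R;H)$. Then for every $\varrho>\varrho_0$ the map $F$ has a unique Lipschitz continuous extension $F_\varrho:H_{\varrho,0}\to H_{\varrho,-1}$. Let $|F_\varrho|_{\mathrm{Lip}}$ be its best Lipschitz constant and assume $$\limsup_{\varrho\to\infty}|F_\varrho|_{\mathrm{Lip}}\cdot\sup_{z\in B(r,r)}\|M(z)\|\cdot\sup_{z\in B(r,r)}\|N(z)\|<1 .$$ Then there is $\varrho_1>\max\{\varrho_0,\frac1{2r}\}$ such that for every $\varrho>\varrho_1$ the equation $$\partial_{0,\varrho}u=M(\partial_{0,\varrho}^{-1})F_\varrho\bigl(N(\partial_{0,\varrho}^{-1})u\bigr)\quad\text{in }H_{\varrho,-1}$$ has a unique solution $u\in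 H_{\varrho,0}$. Moreover the solution operator is causal, in the following sense, for every $\varrho>\varrho_1$: 1. the map $T:x\mapsto\partial_{0,\varrho}^{-1}M(\partial_{0,\varrho}^{-1})F_\varrho(N(\partial_{0,\varrho}^{-1})x)$ is causal on $H_{\varrho,0}$; 2. the solution up to time $a$ depends only on the equation up to time $a$: if $a\in\mathbb R$ and $G:H_{\varrho,0}\to H_{\varrho,-1}$ is any map such that $T(x)=\partial_{0,\varrho}^{-1}G(x)$ a.e. on $(-\infty,a)$ for all $x\in H_{\varrho,0}$, and $v\in H_{\varrho,0}$ is any solution of $\partial_{0,\varrho}v=G(v)$, then $u=v$ a.e. on $(-\infty,a)$. -/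

import Mathlib

open MeasureTheory Filter Topology FourierTransform
open scoped ENNReal NNReal ContDiff

noncomputable section

namespace EvoDelay

/-! ### Exponentially weighted `L²` spaces -/

/-- The measure `exp (-2 ϱ x) dx` on the real line. -/
def expMeasure (ϱ : ℝ) : Measure ℝ :=
  volume.withDensity fun x => ENNReal.ofReal (Real.exp (-2 * ϱ * x))

/-- The Hilbert space `H_{ϱ,0}(ℝ) ⊗ H`, identified with the space of (classes of) functions
`f : ℝ → H` with `∫ ‖f x‖² exp (-2 ϱ x) dx < ∞`, with its Hilbert space norm. -/
abbrev HZero (ϱ : ℝ) (H : Type*) [NormedAddCommGroup H] : Type _ := Lp H 2 (expMeasure ϱ)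

/-- `L²(ℝ; H)` with respect to the Lebesgue measure. -/
abbrev LTwo (H : Type*) [NormedAddCommGroup H] : Type _ := Lp H 2 (volume : Measure ℝ)

section weights

variable {H : Type*} [NormedAddCommGroup H] [InnerProductSpace ℂ H]

theorem measurable_expDensity (ϱ : ℝ) :
    Measurable fun x : ℝ => ENNReal.ofReal (Real.exp (-2 * ϱ * x)) := by fun_prop

theorem expMeasure_ac (ϱ : ℝ) : expMeasure ϱ ≪ volume := withDensity_absolutelyContinuous _ _

theorem ac_expMeasure (ϱ : ℝ) : volume ≪ expMeasure ϱ :=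
  withDensity_absolutelyContinuous' (measurable_expDensity ϱ).aemeasurable
    (ae_of_all _ fun x => by simp [Real.exp_pos])

theorem ae_expMeasure (ϱ : ℝ) : ae (expMeasure ϱ) = ae volume :=
  le_antisymm (expMeasure_ac ϱ).ae_le (ac_expMeasure ϱ).ae_le

theorem eLpNorm_exp_smul (ϱ : ℝ) (f : ℝ → H) :
    eLpNorm (fun x => Real.exp (-ϱ * x) • f x) 2 volume = eLpNorm f 2 (expMeasure ϱ) := by
  rw [eLpNorm_eq_lintegral_rpow_enorm_toReal (by norm_num) (by norm_num),
    eLpNorm_eq_lintegral_rpow_enorm_toReal (by norm_num) (by norm_num), expMeasure,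
    lintegral_withDensity_eq_lintegral_mul_non_measurable _ (measurable_expDensity ϱ)
      (ae_of_all _ fun x => ENNReal.ofReal_lt_top)]
  congr 1
  refine lintegral_congr fun x => ?_
  simp only [enorm_smul, ENNReal.toReal_ofNat, Pi.mul_apply, ENNReal.rpow_ofNat, mul_pow]
  congr 1
  rw [Real.enorm_eq_ofReal (Real.exp_pos _).le, ← ENNReal.ofReal_pow (Real.exp_pos _).le,
    ← Real.exp_nat_mul]
  congr 2
  push_cast
  ring

theorem memLp_exp_smul_iff (ϱ : ℝ) (f : ℝ → H) :
    MemLp (fun x => Real.exp (-ϱ * x) • f x) 2 volume ↔ MemLp f 2 (expMeasure ϱ) := by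
  refine and_congr ⟨fun h => ?_, fun h => ?_⟩ (by rw [eLpNorm_exp_smul])
  · have h2 : AEStronglyMeasurable
        (fun x => Real.exp (ϱ * x) • (Real.exp (-ϱ * x) • f x)) volume :=
      (by fun_prop : Continuous fun x : ℝ => Real.exp (ϱ * x)).aestronglyMeasurable.smul h
    refine AEStronglyMeasurable.mono_ac (expMeasure_ac ϱ) (h2.congr (ae_of_all _ fun x => ?_))
    simp [smul_smul, ← Real.exp_add]
  · exact (by fun_prop : Continuous fun x : ℝ => Real.exp (-ϱ * x)).aestronglyMeasurable.smul
      (h.mono_ac (ac_expMeasure ϱ))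

theorem memLp_exp_smul (ϱ : ℝ) (f : HZero ϱ H) :
    MemLp (fun x => Real.exp (-ϱ * x) • f x) 2 volume :=
  (memLp_exp_smul_iff ϱ _).2 (Lp.memLp f)

theorem memLp_exp_neg_smul (ϱ : ℝ) (g : LTwo H) :
    MemLp (fun x => Real.exp (ϱ * x) • g x) 2 (expMeasure ϱ) := by
  rw [← memLp_exp_smul_iff]
  refine (Lp.memLp g).ae_eq (ae_of_all _ fun x => ?_)
  simp [smul_smul, ← Real.exp_add]

/-- The unitary operator `exp (-ϱ m) : H_{ϱ,0}(ℝ) ⊗ H → L²(ℝ; H)`,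
`f ↦ (x ↦ exp (-ϱ x) f x)`. -/
def expMul (ϱ : ℝ) (H : Type*) [NormedAddCommGroup H] [InnerProductSpace ℂ H] :
    HZero ϱ H ≃ₗᵢ[ℂ] LTwo H where
  toFun f := (memLp_exp_smul ϱ f).toLp
  invFun g := (memLp_exp_neg_smul ϱ g).toLp
  map_add' f g := by
    rw [← MemLp.toLp_add, MemLp.toLp_eq_toLp_iff]
    filter_upwards [(ac_expMeasure ϱ).ae_le (Lp.coeFn_add f g)] with x hx
    rw [hx, Pi.add_apply, Pi.add_apply, smul_add]
  map_smul' c f := by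
    rw [RingHom.id_apply, ← MemLp.toLp_const_smul, MemLp.toLp_eq_toLp_iff]
    filter_upwards [(ac_expMeasure ϱ).ae_le (Lp.coeFn_smul c f)] with x hx
    simp only [hx, Pi.smul_apply]
    rw [smul_comm]
  left_inv f := by
    refine Lp.ext ?_
    filter_upwards [(memLp_exp_neg_smul ϱ (memLp_exp_smul ϱ f).toLp).coeFn_toLp,
      (expMeasure_ac ϱ).ae_le (memLp_exp_smul ϱ f).coeFn_toLp] with x hx hx2
    rw [hx, hx2]
    simp [smul_smul, ← Real.exp_add]
  right_inv g := by
    refine Lp.ext ?_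
    filter_upwards [(memLp_exp_smul ϱ (memLp_exp_neg_smul ϱ g).toLp).coeFn_toLp,
      (ac_expMeasure ϱ).ae_le (memLp_exp_neg_smul ϱ g).coeFn_toLp] with x hx hx2
    rw [hx, hx2]
    simp [smul_smul, ← Real.exp_add]
  norm_map' f := by
    change ‖(memLp_exp_smul ϱ f).toLp‖ = ‖f‖
    rw [Lp.norm_toLp, Lp.norm_def, eLpNorm_exp_smul]

theorem expMul_coe (ϱ : ℝ) (f : HZero ϱ H) :
    expMul ϱ H f =ᵐ[volume] fun x => Real.exp (-ϱ * x) • f x :=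
  (memLp_exp_smul ϱ f).coeFn_toLp

theorem locallyIntegrable_coe (ϱ : ℝ) (f : HZero ϱ H) : LocallyIntegrable f volume := by
  have h1 : LocallyIntegrable (fun x => Real.exp (-ϱ * x) • f x) volume :=
    (memLp_exp_smul ϱ f).locallyIntegrable (by norm_num)
  have h2 : LocallyIntegrable (fun x => Real.exp (ϱ * x) • (Real.exp (-ϱ * x) • f x)) volume := by
    rw [← locallyIntegrableOn_univ] at h1 ⊢
    exact h1.continuousOn_smul (IsOpen.isLocallyClosed isOpen_univ)
      (by fun_prop : Continuous fun x : ℝ => Real.exp (ϱ * x)).continuousOn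
  refine h2.congr (ae_of_all _ fun x => ?_)
  simp [smul_smul, ← Real.exp_add]

end weights

/-! ### The time derivative and the spaces `H_{ϱ,1}` and `H_{ϱ,-1}` -/

section derivative

variable {H : Type*} [NormedAddCommGroup H] [InnerProductSpace ℂ H]

/-- `g` is the distributional derivative of `f` on the real line. -/
def IsWeakDeriv (f g : ℝ → H) : Prop :=
  ∀ φ : ℝ → ℝ, ContDiff ℝ ∞ φ → HasCompactSupport φ →
    ∫ x, deriv φ x • f x = -∫ x, φ x • g x

theorem integrable_test_smul {φ : ℝ → ℝ} (hφ : Continuous φ) (hc : HasCompactSupport φ)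
    {f : ℝ → H} (hf : LocallyIntegrable f volume) : Integrable (fun x => φ x • f x) volume :=
  hf.integrable_smul_left_of_hasCompactSupport hφ hc

/-- The graph of the time derivative `∂_{0,ϱ}` in `(H_{ϱ,0}(ℝ) ⊗ H)²`. Conjugating the weak
derivative on `L²` by `exp (-ϱ m)` and adding `ϱ` gives the weak derivative on the weighted space:
`f` is in the domain if and only if the distributional derivative of `f` is in the weighted
space. -/
def derivGraph (ϱ : ℝ) (H : Type*) [NormedAddCommGroup H] [InnerProductSpace ℂ H] :
    Submodule ℂ (HZero ϱ H × HZero ϱ H) where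
  carrier := {p | IsWeakDeriv (p.1 : ℝ → H) (p.2 : ℝ → H)}
  zero_mem' := by
    intro φ hφ hc
    have h0 : ∀ᵐ x, ((0 : HZero ϱ H) : ℝ → H) x = 0 := (ac_expMeasure ϱ).ae_le (Lp.coeFn_zero _ _ _)
    have h1 : ∫ x, deriv φ x • ((0 : HZero ϱ H) : ℝ → H) x = 0 :=
      integral_eq_zero_of_ae (by filter_upwards [h0] with x hx; rw [hx, smul_zero, Pi.zero_apply])
    have h2 : ∫ x, φ x • ((0 : HZero ϱ H) : ℝ → H) x = 0 :=
      integral_eq_zero_of_ae (by filter_upwards [h0] with x hx; rw [hx, smul_zero, Pi.zero_apply])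
    change ∫ x, deriv φ x • ((0 : HZero ϱ H) : ℝ → H) x = -∫ x, φ x • ((0 : HZero ϱ H) : ℝ → H) x
    rw [h1, h2, neg_zero]
  add_mem' := by
    rintro ⟨a, a'⟩ ⟨b, b'⟩ ha hb φ hφ hc
    have hφ' : Continuous (deriv φ) := hφ.continuous_deriv (by simp)
    have e1 : ∫ x, deriv φ x • ((a + b : HZero ϱ H) : ℝ → H) x
        = (∫ x, deriv φ x • a x) + ∫ x, deriv φ x • b x := by
      rw [← integral_add (integrable_test_smul hφ' hc.deriv (locallyIntegrable_coe ϱ a))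
        (integrable_test_smul hφ' hc.deriv (locallyIntegrable_coe ϱ b))]
      refine integral_congr_ae ?_
      filter_upwards [(ac_expMeasure ϱ).ae_le (Lp.coeFn_add a b)] with x hx
      rw [hx, Pi.add_apply, smul_add]
    have e2 : ∫ x, φ x • ((a' + b' : HZero ϱ H) : ℝ → H) x
        = (∫ x, φ x • a' x) + ∫ x, φ x • b' x := by
      rw [← integral_add (integrable_test_smul hφ.continuous hc (locallyIntegrable_coe ϱ a'))
        (integrable_test_smul hφ.continuous hc (locallyIntegrable_coe ϱ b'))]
      refine integral_congr_ae ?_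
      filter_upwards [(ac_expMeasure ϱ).ae_le (Lp.coeFn_add a' b')] with x hx
      rw [hx, Pi.add_apply, smul_add]
    have ha' : ∫ x, deriv φ x • a x = -∫ x, φ x • a' x := ha φ hφ hc
    have hb' : ∫ x, deriv φ x • b x = -∫ x, φ x • b' x := hb φ hφ hc
    change ∫ x, deriv φ x • ((a + b : HZero ϱ H) : ℝ → H) x
      = -∫ x, φ x • ((a' + b' : HZero ϱ H) : ℝ → H) x
    rw [e1, e2, ha', hb', neg_add]
  smul_mem' := by
    rintro c ⟨a, a'⟩ ha φ hφ hc
    have e1 : ∫ x, deriv φ x • ((c • a : HZero ϱ H) : ℝ → H) x = c • ∫ x, deriv φ x • a x := by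
      rw [← integral_smul]
      refine integral_congr_ae ?_
      filter_upwards [(ac_expMeasure ϱ).ae_le (Lp.coeFn_smul c a)] with x hx
      simp only [hx, Pi.smul_apply]
      rw [smul_comm]
    have e2 : ∫ x, φ x • ((c • a' : HZero ϱ H) : ℝ → H) x = c • ∫ x, φ x • a' x := by
      rw [← integral_smul]
      refine integral_congr_ae ?_
      filter_upwards [(ac_expMeasure ϱ).ae_le (Lp.coeFn_smul c a')] with x hx
      simp only [hx, Pi.smul_apply]
      rw [smul_comm]
    have ha' : ∫ x, deriv φ x • a x = -∫ x, φ x • a' x := ha φ hφ hc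
    change ∫ x, deriv φ x • ((c • a : HZero ϱ H) : ℝ → H) x
      = -∫ x, φ x • ((c • a' : HZero ϱ H) : ℝ → H) x
    rw [e1, e2, ha', smul_neg]

/-- A smooth compactly supported function has a smooth primitive that vanishes near `+∞`. -/
theorem exists_primitive {E : Type*} [NormedAddCommGroup E] [NormedSpace ℝ E] [CompleteSpace E]
    {g : ℝ → E} (hg : ContDiff ℝ ∞ g) (hc : HasCompactSupport g) :
    ∃ (P : ℝ → E) (a b : ℝ), ContDiff ℝ ∞ P ∧ deriv P = g ∧ (∀ x, b ≤ x → P x = 0) ∧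
      ∀ x, x ≤ a → P x = -∫ t, g t := by
  obtain ⟨R, hR⟩ := hc.isCompact.isBounded.subset_closedBall (0 : ℝ)
  have hz : ∀ x, R < |x| → g x = 0 := fun x hx => by
    by_contra h
    have := hR (subset_tsupport g h)
    rw [mem_closedBall_zero_iff, Real.norm_eq_abs] at this
    linarith
  have hd : ∀ x, HasDerivAt (fun x => ∫ t in (|R| + 1)..x, g t) (g x) x := fun x =>
    hg.continuous.integral_hasStrictDerivAt _ _ |>.hasDerivAt
  have hde : deriv (fun x => ∫ t in (|R| + 1)..x, g t) = g := funext fun x => (hd x).deriv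
  refine ⟨fun x => ∫ t in (|R| + 1)..x, g t, -(|R| + 1), |R| + 1, ?_, hde, fun x hx => ?_,
    fun x hx => ?_⟩
  · rw [contDiff_infty_iff_deriv]
    exact ⟨fun x => (hd x).differentiableAt, by rw [hde]; exact hg⟩
  · refine intervalIntegral.integral_zero_ae (ae_of_all _ fun t ht => hz t ?_)
    rw [Set.uIoc_of_le hx] at ht
    have h1 := le_abs_self R
    have h2 := le_abs_self t
    linarith [ht.1]
  · have h3 := abs_nonneg R
    simp only
    rw [intervalIntegral.integral_symm, intervalIntegral.integral_of_le (by linarith),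
      setIntegral_eq_integral_of_forall_compl_eq_zero]
    intro t ht
    have h1 := le_abs_self R
    refine hz t ?_
    rw [Set.mem_Ioc, not_and_or] at ht
    rcases ht with ht | ht
    · have h2 := neg_le_abs t
      linarith
    · have h2 := le_abs_self t
      linarith

theorem const_mem_expMeasure {E : Type*} [NormedAddCommGroup E] (ϱ : ℝ) (c : E) 
    (h : MemLp (fun _ : ℝ => c) 2 (expMeasure ϱ)) : c = 0 := by
  by_contra hne
  rw [memLp_const_iff (by norm_num) (by norm_num)] at h
  rcases h with h | h
  · exact hne h
  · rw [expMeasure, withDensity_apply _ MeasurableSet.univ, setLIntegral_univ] at h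
    rcases le_total 0 ϱ with h0 | h0
    · have : (⊤ : ℝ≥0∞) ≤ ∫⁻ x, ENNReal.ofReal (Real.exp (-2 * ϱ * x)) := by
        calc (⊤ : ℝ≥0∞) = ∫⁻ _ in Set.Iic (0 : ℝ), 1 := by simp
          _ ≤ ∫⁻ x in Set.Iic (0 : ℝ), ENNReal.ofReal (Real.exp (-2 * ϱ * x)) := by
            refine setLIntegral_mono (by fun_prop) fun x hx => ?_
            rw [ENNReal.one_le_ofReal]
            exact Real.one_le_exp (by nlinarith [Set.mem_Iic.1 hx])
          _ ≤ _ := setLIntegral_le_lintegral _ _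
      exact absurd h (not_lt.2 this)
    · have : (⊤ : ℝ≥0∞) ≤ ∫⁻ x, ENNReal.ofReal (Real.exp (-2 * ϱ * x)) := by
        calc (⊤ : ℝ≥0∞) = ∫⁻ _ in Set.Ici (0 : ℝ), 1 := by simp
          _ ≤ ∫⁻ x in Set.Ici (0 : ℝ), ENNReal.ofReal (Real.exp (-2 * ϱ * x)) := by
            refine setLIntegral_mono (by fun_prop) fun x hx => ?_
            rw [ENNReal.one_le_ofReal]
            exact Real.one_le_exp (by nlinarith [Set.mem_Ici.1 hx])
          _ ≤ _ := setLIntegral_le_lintegral _ _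
      exact absurd h (not_lt.2 this)

variable [CompleteSpace H]

theorem eq_zero_of_isWeakDeriv_zero (ϱ : ℝ) (f : HZero ϱ H) (g : HZero ϱ H) (hg : g = 0)
    (h : IsWeakDeriv (f : ℝ → H) (g : ℝ → H)) : f = 0 := by
  have hg0 : ∀ᵐ x, (g : ℝ → H) x = 0 := by
    rw [hg]; exact (ac_expMeasure ϱ).ae_le (Lp.coeFn_zero _ _ _)
  have hf := locallyIntegrable_coe ϱ f
  let η : ContDiffBump (0 : ℝ) := ⟨1, 2, one_pos, one_lt_two⟩
  have hη : ContDiff ℝ ∞ (η.normed volume) := η.contDiff_normed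
  have hηc : HasCompactSupport (η.normed volume) := η.hasCompactSupport_normed
  set c : H := ∫ x, η.normed volume x • f x with hcdef
  have key : ∀ φ : ℝ → ℝ, ContDiff ℝ ∞ φ → HasCompactSupport φ →
      ∫ x, φ x • (f x - c) = 0 := by
    intro φ hφ hc
    set k : ℝ := ∫ x, φ x with hk
    have hφi : Integrable φ volume := hφ.continuous.integrable_of_hasCompactSupport hc
    have hηi : Integrable (η.normed volume) volume :=
      hη.continuous.integrable_of_hasCompactSupport hηc
    have hw : ContDiff ℝ ∞ (fun x => φ x - k * η.normed volume x) :=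
      hφ.sub (contDiff_const.mul hη)
    have hwc : HasCompactSupport (fun x => φ x - k * η.normed volume x) :=
      hc.sub hηc.mul_left
    obtain ⟨P, a, b, hP, hPd, hPb, hPa⟩ := exists_primitive hw hwc
    have hint : ∫ t, (φ t - k * η.normed volume t) = 0 := by
      rw [integral_sub hφi (hηi.const_mul k), integral_const_mul, η.integral_normed]
      simp [hk]
    have hPc : HasCompactSupport P := by
      refine HasCompactSupport.intro (isCompact_Icc (a := a) (b := b)) fun x hx => ?_
      rw [Set.mem_Icc, not_and_or, not_le, not_le] at hx
      rcases hx with hx | hx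
      · rw [hPa x hx.le, hint, neg_zero]
      · exact hPb x hx.le
    have h1 := h P hP hPc
    have h2 : ∫ x, P x • (g : ℝ → H) x = 0 :=
      integral_eq_zero_of_ae (by filter_upwards [hg0] with x hx; rw [hx, smul_zero, Pi.zero_apply])
    rw [h2, neg_zero, hPd] at h1
    have i1 := integrable_test_smul hφ.continuous hc hf
    have i2 := integrable_test_smul hη.continuous hηc hf
    simp_rw [sub_smul, mul_smul] at h1
    have i3 : Integrable (fun x => k • η.normed volume x • f x) volume := i2.smul k
    rw [integral_sub i1 i3, integral_smul, ← hcdef, sub_eq_zero] at h1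
    simp_rw [smul_sub]
    rw [integral_sub i1 (hφi.smul_const c), integral_smul_const, h1, ← hk, sub_self]
  have hfc : ∀ᵐ x, (f : ℝ → H) x - c = 0 :=
    ae_eq_zero_of_integral_contDiff_smul_eq_zero
      (hf.sub (continuous_const.locallyIntegrable)) key
  have hfc' : (f : ℝ → H) =ᵐ[expMeasure ϱ] fun _ => c := by
    refine (expMeasure_ac ϱ).ae_le ?_
    filter_upwards [hfc] with x hx
    exact sub_eq_zero.1 hx
  have hc0 := const_mem_expMeasure ϱ c ((Lp.memLp f).ae_eq hfc')
  refine Lp.ext ?_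
  filter_upwards [hfc', Lp.coeFn_zero H 2 (expMeasure ϱ)] with x hx hx2
  rw [hx, hx2, hc0]
  rfl

/-- The space `H_{ϱ,1}(ℝ) ⊗ H`: the domain of `∂_{0,ϱ}`, an element being stored together with
its derivative. Its norm is `|φ|_{ϱ,1} = |∂_{0,ϱ} φ|_{ϱ,0}`. -/
def HOne (ϱ : ℝ) (H : Type*) [NormedAddCommGroup H] [InnerProductSpace ℂ H] : Type _ :=
  derivGraph ϱ H

instance (ϱ : ℝ) : AddCommGroup (HOne ϱ H) := inferInstanceAs (AddCommGroup (derivGraph ϱ H))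

instance (ϱ : ℝ) : Module ℂ (HOne ϱ H) := inferInstanceAs (Module ℂ (derivGraph ϱ H))

/-- The derivative `∂_{0,ϱ} : H_{ϱ,1} → H_{ϱ,0}` as a linear map. -/
def derivOneLin (ϱ : ℝ) (H : Type*) [NormedAddCommGroup H] [InnerProductSpace ℂ H] :
    HOne ϱ H →ₗ[ℂ] HZero ϱ H :=
  (LinearMap.snd ℂ (HZero ϱ H) (HZero ϱ H)).comp (derivGraph ϱ H).subtype

theorem derivOneLin_injective (ϱ : ℝ) : Function.Injective (derivOneLin ϱ H) := by
  rw [← LinearMap.ker_eq_bot, LinearMap.ker_eq_bot']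
  intro p hp
  have hp' : p.1.2 = 0 := hp
  exact Subtype.ext (Prod.ext (eq_zero_of_isWeakDeriv_zero ϱ p.1.1 p.1.2 hp' p.2) hp')

instance (ϱ : ℝ) : NormedAddCommGroup (HOne ϱ H) :=
  NormedAddCommGroup.induced (HOne ϱ H) (HZero ϱ H) (derivOneLin ϱ H) (derivOneLin_injective ϱ)

instance (ϱ : ℝ) : NormedSpace ℂ (HOne ϱ H) :=
  NormedSpace.induced ℂ (HOne ϱ H) (HZero ϱ H) (derivOneLin ϱ H)

/-- The derivative `∂_{0,ϱ} : H_{ϱ,1} → H_{ϱ,0}`. -/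
def derivOne (ϱ : ℝ) (H : Type*) [NormedAddCommGroup H] [InnerProductSpace ℂ H]
    [CompleteSpace H] : HOne ϱ H →ₗᵢ[ℂ] HZero ϱ H :=
  ⟨derivOneLin ϱ H, fun _ => rfl⟩

/-- The space `H_{ϱ,-1}(ℝ) ⊗ H`: the dual space of `H_{-ϱ,1}(ℝ) ⊗ H`, with the dual norm. -/
abbrev HNeg (ϱ : ℝ) (H : Type*) [NormedAddCommGroup H] [InnerProductSpace ℂ H]
    [CompleteSpace H] : Type _ := StrongDual ℂ (HOne (-ϱ) H)

/-- The functional `ψ ↦ ⟨φ, ψ⟩_{0,0} = ⟨exp (-ϱ m) φ, exp (ϱ m) ψ⟩` on `H_{-ϱ,0}(ℝ) ⊗ H` given by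
`φ ∈ H_{ϱ,0}(ℝ) ⊗ H`. The inner product is conjugate linear in the first argument. -/
def pairing (ϱ : ℝ) (φ : HZero ϱ H) : StrongDual ℂ (HZero (-ϱ) H) :=
  (innerSL ℂ (expMul ϱ H φ)).comp (expMul (-ϱ) H).toLinearIsometry.toContinuousLinearMap

/-- The time derivative `∂_{0,ϱ} : H_{ϱ,0}(ℝ) ⊗ H → H_{ϱ,-1}(ℝ) ⊗ H`,
`φ ↦ (ψ ↦ ⟨φ, -∂_{0,-ϱ} ψ⟩_{0,0})`. -/
def timeDeriv (ϱ : ℝ) (φ : HZero ϱ H) : HNeg ϱ H :=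
  (pairing ϱ φ).comp (-(derivOne (-ϱ) H).toContinuousLinearMap)

/-- The inverse `∂_{0,ϱ}⁻¹ : H_{ϱ,-1}(ℝ) ⊗ H → H_{ϱ,0}(ℝ) ⊗ H` of the bijection `timeDeriv ϱ`
(see `timeDeriv_bijective` for `ϱ > 0`). -/
def timeDerivInv (ϱ : ℝ) : HNeg ϱ H → HZero ϱ H := Function.invFun (timeDeriv ϱ)

theorem timeDeriv_surjective (ϱ : ℝ) : Function.Surjective (timeDeriv (H := H) ϱ) := by
  intro Λ
  let e := (derivOne (-ϱ) H).equivRange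
  obtain ⟨L, hL, -⟩ := exists_extension_norm_eq (𝕜 := ℂ) _
    (Λ.comp e.symm.toLinearIsometry.toContinuousLinearMap)
  let L2 : StrongDual ℂ (LTwo H) :=
    L.comp (expMul (-ϱ) H).symm.toLinearIsometry.toContinuousLinearMap
  let g : LTwo H := (InnerProductSpace.toDual ℂ (LTwo H)).symm L2
  refine ⟨(expMul ϱ H).symm (-g), ?_⟩
  ext ψ
  have h1 : L (derivOne (-ϱ) H ψ) = Λ ψ := by
    have h3 := hL (e ψ)
    rw [ContinuousLinearMap.comp_apply] at h3
    have h4 : e.symm.toLinearIsometry.toContinuousLinearMap (e ψ) = ψ := e.symm_apply_apply ψ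
    rw [h4] at h3
    exact h3
  have h2 : inner ℂ g (expMul (-ϱ) H (derivOne (-ϱ) H ψ)) = L (derivOne (-ϱ) H ψ) := by
    rw [InnerProductSpace.toDual_symm_apply]
    simp [L2]
  rw [← h1, ← h2]
  simp [timeDeriv, pairing]

end derivative

/-! ### Test functions -/

section testFunctions

/-- The space of smooth functions `ℝ → H` with compact support. -/
def Test (H : Type*) [NormedAddCommGroup H] [InnerProductSpace ℂ H] : Submodule ℂ (ℝ → H) where
  carrier := {φ | ContDiff ℝ ∞ φ ∧ HasCompactSupport φ}
  zero_mem' := ⟨contDiff_const, HasCompactSupport.zero⟩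
  add_mem' := fun ha hb => ⟨ha.1.add hb.1, ha.2.add hb.2⟩
  smul_mem' := fun c _ ha => ⟨ha.1.const_smul c, ha.2.smul_left (f := fun _ => c)⟩

/-- The space of smooth functions `ψ : ℝ → H` with `sup supp ψ < ∞` some derivative of which
(of order `n ≥ 0`) has compact support. -/
def TestPlus (H : Type*) [NormedAddCommGroup H] [InnerProductSpace ℂ H] :
    Submodule ℂ (ℝ → H) where
  carrier := {ψ | ContDiff ℝ ∞ ψ ∧ BddAbove (tsupport ψ) ∧
    ∃ n : ℕ, HasCompactSupport (iteratedDeriv n ψ)}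
  zero_mem' := ⟨contDiff_const, by simp [tsupport], 0, by
    rw [iteratedDeriv_zero]; exact HasCompactSupport.zero⟩
  add_mem' := by
    rintro a b ⟨ha, hab, n, hn⟩ ⟨hb, hbb, m, hm⟩
    have aux : ∀ (c : ℝ → H) (p q : ℕ), HasCompactSupport (iteratedDeriv p c) →
        HasCompactSupport (iteratedDeriv (p + q) c) := by
      intro c p q h
      induction q with
      | zero => exact h
      | succ q ih =>
        rw [← add_assoc, iteratedDeriv_succ]
        exact ih.deriv
    refine ⟨ha.add hb, (hab.union hbb).mono (tsupport_add a b), n + m, ?_⟩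
    have : iteratedDeriv (n + m) (a + b) = iteratedDeriv (n + m) a + iteratedDeriv (n + m) b := by
      ext x
      exact iteratedDeriv_add (ha.of_le (by exact_mod_cast le_top)).contDiffAt
        (hb.of_le (by exact_mod_cast le_top)).contDiffAt
    rw [this]
    refine (aux a n m hn).add ?_
    rw [add_comm]
    exact aux b m n hm
  smul_mem' := by
    rintro c a ⟨ha, hab, n, hn⟩
    refine ⟨ha.const_smul c, hab.mono (tsupport_smul_subset_right (fun _ => c) a), n, ?_⟩
    have : iteratedDeriv n (c • a) = c • iteratedDeriv n a := by
      ext x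
      exact iteratedDeriv_const_smul_field c a
    rw [this]
    exact hn.smul_left (f := fun _ => c)

variable {H : Type*} [NormedAddCommGroup H] [InnerProductSpace ℂ H]

theorem memLp_test (ϱ : ℝ) (φ : Test H) : MemLp (φ : ℝ → H) 2 (expMeasure ϱ) := by
  rw [← memLp_exp_smul_iff]
  have hc : Continuous fun x : ℝ => Real.exp (-ϱ * x) • (φ : ℝ → H) x :=
    (by fun_prop : Continuous fun x : ℝ => Real.exp (-ϱ * x)).smul φ.2.1.continuous
  exact hc.memLp_of_hasCompactSupport φ.2.2.smul_left

/-- A compactly supported smooth function as an element of `H_{ϱ,0}(ℝ) ⊗ H`. -/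
def Test.toHZero (ϱ : ℝ) (φ : Test H) : HZero ϱ H := (memLp_test ϱ φ).toLp

theorem TestPlus.deriv_mem {ψ : ℝ → H} (h : ψ ∈ TestPlus H) : deriv ψ ∈ TestPlus H := by
  obtain ⟨h1, h2, n, h3⟩ := h
  refine ⟨(contDiff_infty_iff_deriv.1 h1).2, h2.mono tsupport_deriv_subset, n, ?_⟩
  rw [← iteratedDeriv_succ', iteratedDeriv_succ]
  exact h3.deriv

theorem TestPlus.isWeakDeriv {ψ : ℝ → H} (h : ψ ∈ TestPlus H) : IsWeakDeriv ψ (deriv ψ) := by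
  intro φ hφ hc
  have hd : Continuous (deriv ψ) := (contDiff_infty_iff_deriv.1 h.1).2.continuous
  have hφ' : Continuous (deriv φ) := hφ.continuous_deriv (by simp)
  have i1 := integrable_test_smul hφ' hc.deriv h.1.continuous.locallyIntegrable
  have i2 := integrable_test_smul hφ.continuous hc hd.locallyIntegrable
  have i3 := integrable_test_smul hφ.continuous hc h.1.continuous.locallyIntegrable
  have h0 : ∫ x, (φ x • deriv ψ x + deriv φ x • ψ x) = 0 :=
    integral_eq_zero_of_hasDerivAt_of_integrable
      (fun x => (hφ.differentiable (by simp) x).hasDerivAt.smul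
        (h.1.differentiable (by simp) x).hasDerivAt) (i2.add i1) i3
  rw [integral_add i2 i1, add_comm] at h0
  exact eq_neg_of_add_eq_zero_left h0

variable [CompleteSpace H]

theorem TestPlus.exp_bound (n : ℕ) : ∀ (ψ : ℝ → H), ContDiff ℝ ∞ ψ → BddAbove (tsupport ψ) →
    HasCompactSupport (iteratedDeriv n ψ) → ∀ δ : ℝ, 0 < δ →
      ∃ C : ℝ, 0 ≤ C ∧ ∀ x, ‖ψ x‖ ≤ C * Real.exp (-δ * x) := by
  induction n with
  | zero =>
    intro ψ h1 _ h3 δ _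
    rw [iteratedDeriv_zero] at h3
    have hc : Continuous fun x : ℝ => Real.exp (δ * x) • ψ x :=
      (by fun_prop : Continuous fun x : ℝ => Real.exp (δ * x)).smul h1.continuous
    obtain ⟨C, hC⟩ := h3.smul_left.exists_bound_of_continuous hc
    refine ⟨C, (norm_nonneg _).trans (hC 0), fun x => ?_⟩
    have h4 := hC x
    change ‖Real.exp (δ * x) • ψ x‖ ≤ C at h4
    rw [norm_smul, Real.norm_of_nonneg (Real.exp_pos _).le] at h4
    rw [neg_mul, Real.exp_neg, ← div_eq_mul_inv, le_div_iff₀ (Real.exp_pos _)]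
    linarith
  | succ n ih =>
    intro ψ h1 h2 h3 δ hδ
    rw [iteratedDeriv_succ'] at h3
    have hd : ContDiff ℝ ∞ (deriv ψ) := (contDiff_infty_iff_deriv.1 h1).2
    obtain ⟨C, hC0, hC⟩ := ih (deriv ψ) hd (h2.mono tsupport_deriv_subset) h3 δ hδ
    obtain ⟨b, hb⟩ := h2
    have hz : ∀ x, b < x → ψ x = 0 := fun x hx => by
      by_contra h
      exact absurd (hb (subset_tsupport ψ h)) (not_le.2 hx)
    refine ⟨C / δ, by positivity, fun x => ?_⟩
    rcases lt_or_ge b x with hx | hx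
    · rw [hz x hx, norm_zero]
      positivity
    · have hx' : x ≤ b + 1 := by linarith
      have e1 : ∫ t in x..(b + 1), deriv ψ t = ψ (b + 1) - ψ x :=
        intervalIntegral.integral_deriv_eq_sub
          (fun t _ => (h1.differentiable (by simp)).differentiableAt)
          (hd.continuous.intervalIntegrable _ _)
      rw [hz (b + 1) (by linarith), zero_sub] at e1
      have e2 : ∫ t in x..(b + 1), C * Real.exp (-δ * t)
          = C / δ * Real.exp (-δ * x) - C / δ * Real.exp (-δ * (b + 1)) := by
        have hder : ∀ t ∈ Set.uIcc x (b + 1),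
            HasDerivAt (fun t => -(C / δ) * Real.exp (-δ * t)) (C * Real.exp (-δ * t)) t := by
          intro t _
          have h5 := (((hasDerivAt_id t).const_mul (-δ)).exp).const_mul (-(C / δ))
          refine h5.congr_deriv ?_
          simp only [id]
          field_simp
        rw [intervalIntegral.integral_eq_sub_of_hasDerivAt hder
          ((by fun_prop : Continuous fun t : ℝ => C * Real.exp (-δ * t)).intervalIntegrable _ _)]
        ring
      have e3 : ‖∫ t in x..(b + 1), deriv ψ t‖ ≤ ∫ t in x..(b + 1), C * Real.exp (-δ * t) :=
        intervalIntegral.norm_integral_le_of_norm_le hx' (ae_of_all _ fun t _ => hC t)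
          ((by fun_prop : Continuous fun t : ℝ => C * Real.exp (-δ * t)).intervalIntegrable _ _)
      rw [e1, norm_neg, e2] at e3
      have : 0 ≤ C / δ * Real.exp (-δ * (b + 1)) := by positivity
      linarith

theorem TestPlus.memLp {ϱ : ℝ} (hϱ : 0 < ϱ) {ψ : ℝ → H} (h : ψ ∈ TestPlus H) :
    MemLp ψ 2 (expMeasure (-ϱ)) := by
  obtain ⟨h1, h2, n, h3⟩ := h
  obtain ⟨C, hC0, hC⟩ := TestPlus.exp_bound n ψ h1 h2 h3 (ϱ / 2) (by positivity)
  obtain ⟨b, hb⟩ := h2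
  have hz : ∀ x, b < x → ψ x = 0 := fun x hx => by
    by_contra h
    exact absurd (hb (subset_tsupport ψ h)) (not_le.2 hx)
  rw [← memLp_exp_smul_iff]
  have hcont : Continuous fun x : ℝ => Real.exp (-(-ϱ) * x) • ψ x :=
    (by fun_prop : Continuous fun x : ℝ => Real.exp (-(-ϱ) * x)).smul h1.continuous
  rw [memLp_two_iff_integrable_sq_norm hcont.aestronglyMeasurable]
  have hdom : Integrable (Set.indicator (Set.Iic b) fun x => C ^ 2 * Real.exp (ϱ * x)) volume := by
    rw [integrable_indicator_iff measurableSet_Iic]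
    exact (integrableOn_exp_mul_Iic hϱ b).const_mul _
  refine hdom.mono' (hcont.norm.pow 2).aestronglyMeasurable (ae_of_all _ fun x => ?_)
  rw [norm_smul, Real.norm_of_nonneg (Real.exp_pos _).le, Real.norm_of_nonneg (by positivity)]
  by_cases hx : x ≤ b
  · rw [Set.indicator_of_mem (Set.mem_Iic.2 hx)]
    have h5 : Real.exp (-(-ϱ) * x) * ‖ψ x‖ ≤ C * Real.exp (ϱ / 2 * x) := by
      calc _ ≤ Real.exp (-(-ϱ) * x) * (C * Real.exp (-(ϱ / 2) * x)) := by gcongr; exact hC x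
        _ = C * (Real.exp (-(-ϱ) * x) * Real.exp (-(ϱ / 2) * x)) := by ring
        _ = _ := by rw [← Real.exp_add]; ring_nf
    calc _ ≤ (C * Real.exp (ϱ / 2 * x)) ^ 2 := by gcongr
      _ = _ := by
        rw [mul_pow, ← Real.exp_nat_mul]
        congr 2
        push_cast
        ring
  · rw [hz x (not_le.1 hx), Set.indicator_of_notMem (by simpa using hx)]
    simp

/-- For `ϱ > 0`, an element of `TestPlus H` as an element of `H_{-ϱ,1}(ℝ) ⊗ H`. -/
def TestPlus.toHOne {ϱ : ℝ} (hϱ : 0 < ϱ) (ψ : TestPlus H) : HOne (-ϱ) H :=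
  ⟨((TestPlus.memLp hϱ ψ.2).toLp, (TestPlus.memLp hϱ (TestPlus.deriv_mem ψ.2)).toLp), by
    intro φ hφ hc
    have a1 := (ac_expMeasure (-ϱ)).ae_le (TestPlus.memLp hϱ ψ.2).coeFn_toLp
    have a2 := (ac_expMeasure (-ϱ)).ae_le
      (TestPlus.memLp hϱ (TestPlus.deriv_mem ψ.2)).coeFn_toLp
    have e1 : ∫ x, deriv φ x • ((TestPlus.memLp hϱ ψ.2).toLp : ℝ → H) x
        = ∫ x, deriv φ x • (ψ : ℝ → H) x :=
      integral_congr_ae (by filter_upwards [a1] with x hx; rw [hx])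
    have e2 : ∫ x, φ x • ((TestPlus.memLp hϱ (TestPlus.deriv_mem ψ.2)).toLp : ℝ → H) x
        = ∫ x, φ x • deriv (ψ : ℝ → H) x :=
      integral_congr_ae (by filter_upwards [a2] with x hx; rw [hx])
    exact e1.trans ((TestPlus.isWeakDeriv ψ.2 φ hφ hc).trans (congrArg Neg.neg e2.symm))⟩

theorem timeDeriv_injective {ϱ : ℝ} (hϱ : 0 < ϱ) :
    Function.Injective (timeDeriv (H := H) ϱ) := by
  intro u v huv
  set w : HZero ϱ H := u - v with hw
  have h1 : ∀ Ψ : HOne (-ϱ) H,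
      inner ℂ (expMul ϱ H w) (expMul (-ϱ) H (derivOne (-ϱ) H Ψ)) = 0 := by
    intro Ψ
    have h2 : timeDeriv ϱ u Ψ = timeDeriv ϱ v Ψ := by rw [huv]
    simp only [timeDeriv, pairing, ContinuousLinearMap.comp_apply, innerSL_apply_apply,
      neg_apply, map_neg, neg_inj] at h2
    rw [hw, map_sub, inner_sub_left, sub_eq_zero]
    exact h2
  have hwl := locallyIntegrable_coe ϱ w
  have h3 : ∀ χ : ℝ → ℝ, ContDiff ℝ ∞ χ → HasCompactSupport χ → ∫ x, χ x • w x = 0 := by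
    intro χ hχ hc
    refine ext_inner_right ℂ fun h => ?_
    have hg : ContDiff ℝ ∞ fun x => χ x • h := hχ.smul contDiff_const
    obtain ⟨P, a, b, hP, hPd, hPb, -⟩ := exists_primitive hg hc.smul_right
    have hmem : P ∈ TestPlus H := by
      refine ⟨hP, ⟨b, fun x hx => ?_⟩, 1, ?_⟩
      · refine closure_minimal (fun y hy => ?_) isClosed_Iic hx
        by_contra hyb
        exact hy (hPb y (not_le.1 hyb).le)
      · rw [iteratedDeriv_one, hPd]
        exact hc.smul_right
    have h4 := h1 (TestPlus.toHOne hϱ ⟨P, hmem⟩)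
    rw [L2.inner_def] at h4
    have hD : (derivOne (-ϱ) H (TestPlus.toHOne hϱ ⟨P, hmem⟩) : ℝ → H)
        =ᵐ[volume] fun x => χ x • h := by
      have := (ac_expMeasure (-ϱ)).ae_le
        (TestPlus.memLp hϱ (TestPlus.deriv_mem hmem)).coeFn_toLp
      filter_upwards [this] with x hx
      exact hx.trans (congrFun hPd x)
    have h5 : ∫ x, inner ℂ (expMul ϱ H w x)
        (expMul (-ϱ) H (derivOne (-ϱ) H (TestPlus.toHOne hϱ ⟨P, hmem⟩)) x)
        = ∫ x, inner ℂ (χ x • w x) h := by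
      refine integral_congr_ae ?_
      filter_upwards [expMul_coe ϱ w, hD,
        expMul_coe (-ϱ) (derivOne (-ϱ) H (TestPlus.toHOne hϱ ⟨P, hmem⟩))] with x hx1 hx2 hx3
      rw [hx1, hx3, hx2, smul_smul, inner_smul_left_eq_star_smul, inner_smul_right_eq_smul,
        inner_smul_left_eq_star_smul, smul_smul]
      congr 1
      have : Real.exp (-ϱ * x) * Real.exp (-(-ϱ) * x) = 1 := by
        rw [← Real.exp_add]; simp
      rw [← mul_assoc, conj_trivial, conj_trivial, this, one_mul]
    rw [h5] at h4
    have h6 := integral_inner (𝕜 := ℂ) (integrable_test_smul hχ.continuous hc hwl) h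
    rw [inner_zero_left, ← inner_conj_symm, ← h6, ← integral_conj]
    simp_rw [inner_conj_symm]
    exact h4
  have h7 : ∀ᵐ x, w x = 0 := ae_eq_zero_of_integral_contDiff_smul_eq_zero hwl h3
  have h8 : w = 0 := by
    refine Lp.ext ?_
    filter_upwards [(expMeasure_ac ϱ).ae_le h7, Lp.coeFn_zero H 2 (expMeasure ϱ)] with x hx hx2
    rw [hx, hx2]
    rfl
  exact sub_eq_zero.1 h8

theorem timeDeriv_bijective {ϱ : ℝ} (hϱ : 0 < ϱ) : Function.Bijective (timeDeriv (H := H) ϱ) :=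
  ⟨timeDeriv_injective hϱ, timeDeriv_surjective ϱ⟩

end testFunctions

/-! ### Functions of `∂_{0,ϱ}⁻¹` -/

section functionalCalculus

variable {H : Type*} [NormedAddCommGroup H] [InnerProductSpace ℂ H]

open Classical in
/-- Multiplication by an operator-valued function on `L²(ℝ; H)` (with the value `0` at those `g`
for which the product is not in `L²`; for bounded continuous `m` there are none, see
`memLp_multiplier`). -/
def multiplier (m : ℝ → H →L[ℂ] H) (g : LTwo H) : LTwo H :=
  if h : MemLp (fun ξ => m ξ (g ξ)) 2 volume then h.toLp else 0

theorem memLp_multiplier {m : ℝ → H →L[ℂ] H} (hm : Continuous m) {C : ℝ}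
    (hC : ∀ ξ, ‖m ξ‖ ≤ C) (g : LTwo H) : MemLp (fun ξ => m ξ (g ξ)) 2 volume :=
  MemLp.of_le_mul (c := C) (Lp.memLp g)
    ((isBoundedBilinearMap_apply (𝕜 := ℂ)).continuous.comp_aestronglyMeasurable
      (hm.aestronglyMeasurable.prodMk (Lp.memLp g).1))
    (ae_of_all _ fun ξ => (m ξ).le_of_opNorm_le (hC ξ) _)

variable [CompleteSpace H]

/-- The operator `M(∂_{0,ϱ}⁻¹) = 𝓛_ϱ* M(1 / (i m + ϱ)) 𝓛_ϱ` on `H_{ϱ,0}(ℝ) ⊗ H`, where `𝓛_ϱ` is the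
Fourier transform composed with `exp (-ϱ m)`. The kernel of the Fourier transform `𝓕` is
`exp (-2 π i x ξ)`, so that the spectral variable of the transform with kernel
`(2 π)^(-1/2) exp (-i x t)` is `t = 2 π ξ`; the two differ by a unitary dilation. -/
def funcCalc (ϱ : ℝ) (M : ℂ → H →L[ℂ] H) (u : HZero ϱ H) : HZero ϱ H :=
  (expMul ϱ H).symm (𝓕⁻ (multiplier
    (fun ξ => M (1 / (Complex.I * ((2 * Real.pi * ξ : ℝ) : ℂ) + (ϱ : ℂ)))) (𝓕 (expMul ϱ H u))))

/-- The extension of `M(∂_{0,ϱ}⁻¹)` to `H_{ϱ,-1}(ℝ) ⊗ H`,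
`φ ↦ (ψ ↦ ⟨M(∂_{0,ϱ}⁻¹) ∂_{0,ϱ}⁻¹ φ, -∂_{0,-ϱ} ψ⟩_{0,0})`. -/
def funcCalcNeg (ϱ : ℝ) (M : ℂ → H →L[ℂ] H) (φ : HNeg ϱ H) : HNeg ϱ H :=
  timeDeriv ϱ (funcCalc ϱ M (timeDerivInv ϱ φ))

end functionalCalculus

/-! ### Nonlinear right-hand sides and causality -/

section equations

variable {H : Type*} [NormedAddCommGroup H] [InnerProductSpace ℂ H] [CompleteSpace H]

/-- The hypothesis of the Picard--Lindelöf theorem for a map `F` from the compactly supported smooth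
functions to the linear functionals on `TestPlus H`: for all `ϱ > ϱ₀` there is `K > 0` with
`|F(0)(ψ)| ≤ K |ψ|_{-ϱ,1}` and `|F(u)(ψ) - F(w)(ψ)| ≤ s |ψ|_{-ϱ,1} |u - w|_{ϱ,0}`. -/
def PicardLindelofCondition (ϱ₀ s : ℝ) (F : Test H → (TestPlus H →ₗ[ℂ] ℂ)) : Prop :=
  ∀ (ϱ : ℝ) (hϱ : 0 < ϱ), ϱ₀ < ϱ → ∃ K : ℝ, 0 < K ∧ ∀ (u w : Test H) (ψ : TestPlus H),
    ‖F 0 ψ‖ ≤ K * ‖TestPlus.toHOne hϱ ψ‖ ∧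
    ‖F u ψ - F w ψ‖ ≤ s * ‖TestPlus.toHOne hϱ ψ‖ * ‖Test.toHZero ϱ (u - w)‖

/-- `G : H_{ϱ,0}(ℝ) ⊗ H → H_{ϱ,-1}(ℝ) ⊗ H` is a Lipschitz continuous extension of `F`. -/
def IsLipschitzExtension (F : Test H → (TestPlus H →ₗ[ℂ] ℂ)) (ϱ : ℝ)
    (G : HZero ϱ H → HNeg ϱ H) : Prop :=
  (∃ K : ℝ≥0, LipschitzWith K G) ∧
    ∀ (hϱ : 0 < ϱ) (u : Test H) (ψ : TestPlus H),
      G (Test.toHZero ϱ u) (TestPlus.toHOne hϱ ψ) = F u ψ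

open Classical in
/-- The Lipschitz continuous extension `F_ϱ` of `F`. -/
def lipExtension (F : Test H → (TestPlus H →ₗ[ℂ] ℂ)) (ϱ : ℝ) : HZero ϱ H → HNeg ϱ H :=
  if h : ∃ G, IsLipschitzExtension F ϱ G then h.choose else 0

/-- The best Lipschitz constant of a map, in `[0, ∞]`. -/
def lipConst {X Y : Type*} [PseudoEMetricSpace X] [PseudoEMetricSpace Y] (G : X → Y) : ℝ≥0∞ :=
  ⨅ (K : ℝ≥0) (_ : LipschitzWith K G), (K : ℝ≥0∞)

/-- The functions `x` and `y` coincide almost everywhere on `(-∞, a)`, that is,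
`χ_{(-∞, a)}(m) (x - y) = 0`. -/
def AgreeBefore (a : ℝ) (x y : ℝ → H) : Prop := ∀ᵐ t : ℝ, t < a → x t = y t

/-- Causality of a map on `H_{ϱ,0}(ℝ) ⊗ H`. -/
def IsCausal {ϱ : ℝ} (W : HZero ϱ H → HZero ϱ H) : Prop :=
  ∀ (a : ℝ) (x y : HZero ϱ H), AgreeBefore a x y → AgreeBefore a (W x) (W y)

/-- The right-hand side `u ↦ M(∂_{0,ϱ}⁻¹) F_ϱ(N(∂_{0,ϱ}⁻¹) u)`. -/
def rightHandSide (M N : ℂ → H →L[ℂ] H) (F : Test H → (TestPlus H →ₗ[ℂ] ℂ)) (ϱ : ℝ)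
    (u : HZero ϱ H) : HNeg ϱ H :=
  funcCalcNeg ϱ M (lipExtension F ϱ (funcCalc ϱ N u))

end equations

end EvoDelay

end

/-!
With `T u = ∂_{0,ϱ}⁻¹ M(∂_{0,ϱ}⁻¹) F_ϱ(N(∂_{0,ϱ}⁻¹) u)` the equation reads `u = T u`. The time
derivative is an isometry from `H_{ϱ,0}` onto `H_{ϱ,-1}`, because the derivatives of the elements of
`TestPlus H` include all compactly supported smooth functions, which are dense in `H_{-ϱ,0}`. By
Plancherel's theorem `M(∂_{0,ϱ}⁻¹)` and `N(∂_{0,ϱ}⁻¹)` are bounded by the suprema of `M` and `N` on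
the disc, since `1 / (i t + ϱ)` lies in the disc for `ϱ > 1 / (2 r)`. The condition on the upper
limit thus makes `T` a contraction for all large `ϱ`, and Banach's fixed point theorem applies.

Causality of each of the three factors of `T` follows from one principle,
`isCausal_of_uniform_lipschitz`: if operators `S_ν` on `H_{ν,0}`, `ν ≥ ϱ`, have a common Lipschitz
constant and the values on test functions do not depend on `ν`, then `S_ϱ` is causal. Indeed, if two
test functions differ only after time `a`, the `H_{ν,0}`-norm of the difference is of order
`exp (-ν a)`, hence so is that of the difference of the images; but a fixed nonzero function on
`(-∞, b)` with `b < a` has a norm of order at least `exp (-ν b)`, and `ν → ∞` gives equality of the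
images before `a`. General arguments are approximated by test functions.

Independence of the weight holds for `∂_{0,ϱ}⁻¹ F_ϱ` because `F` is given on test functions without
reference to a weight (`timeDerivInv_lipExtension_test`). For `M(∂_{0,ϱ}⁻¹)` the pairing of
`M(∂_{0,ϱ}⁻¹) φ` with a test function is, by Plancherel, the integral over the line `Re z = ϱ` of a
holomorphic function built from `M(1 / z)` and two Laplace transforms; it is `O(|z|⁻²)`
on vertical strips, so Cauchy's theorem allows moving the line (`integral_pairingIntegrand_eq`).

For uniqueness up to time `a`, a function `v` with `v = T v` before `a` is replaced by `u` after
`a`; this changes neither side before `a`, and the contraction estimate forces the patched function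
to be `u` (`agreeBefore_of_isCausal`).
-/

noncomputable section

namespace EvoDelay

set_option linter.unusedSectionVars false

variable {H : Type*} [NormedAddCommGroup H] [InnerProductSpace ℂ H]

/-! ### Pairings and density of test functions -/

theorem exp_smul_inner_exp_smul (a b : ℝ) (u v : H) :
    inner ℂ (Real.exp a • u) (Real.exp b • v) = Real.exp (a + b) • inner ℂ u v := by
  rw [inner_smul_left_eq_star_smul, inner_smul_right_eq_smul, smul_smul, conj_trivial,
    Real.exp_add]

theorem inner_hZero (ϱ : ℝ) (u v : HZero ϱ H) :
    inner ℂ u v = ∫ x, Real.exp (-2 * ϱ * x) • inner ℂ (u x) (v x) := by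
  rw [← (expMul ϱ H).inner_map_map u v, L2.inner_def]
  refine integral_congr_ae ?_
  filter_upwards [expMul_coe ϱ u, expMul_coe ϱ v] with x h1 h2
  rw [h1, h2, exp_smul_inner_exp_smul]
  ring_nf

theorem pairing_apply (ϱ : ℝ) (u : HZero ϱ H) (v : HZero (-ϱ) H) :
    pairing ϱ u v = ∫ x, inner ℂ (u x) (v x) := by
  change inner ℂ (expMul ϱ H u) (expMul (-ϱ) H v) = _
  rw [L2.inner_def]
  refine integral_congr_ae ?_
  filter_upwards [expMul_coe ϱ u, expMul_coe (-ϱ) v] with x h1 h2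
  rw [h1, h2, exp_smul_inner_exp_smul]
  simp

/-- Scalar test functions times vectors suffice to detect a locally integrable function. -/
theorem ae_eq_zero_of_integral_inner_smul [CompleteSpace H] {f : ℝ → H}
    (hf : LocallyIntegrable f volume) {U : Set ℝ} (hU : IsOpen U)
    (h : ∀ (χ : ℝ → ℝ) (h : H), ContDiff ℝ ∞ χ → HasCompactSupport χ → tsupport χ ⊆ U →
      ∫ x, inner ℂ (f x) (χ x • h) = 0) : ∀ᵐ x, x ∈ U → f x = 0 := by
  refine hU.ae_eq_zero_of_integral_contDiff_smul_eq_zero (hf.locallyIntegrableOn U)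
    fun χ hχ hc hs => ?_
  refine ext_inner_left ℂ fun v => ?_
  rw [inner_zero_right, ← integral_inner (integrable_test_smul hχ.continuous hc hf) v,
    ← star_eq_zero]
  refine Eq.trans ?_ (h χ v hχ hc hs)
  rw [← starRingEnd_apply, ← integral_conj]
  refine integral_congr_ae (ae_of_all _ fun x => ?_)
  simp only [inner_conj_symm]
  rw [inner_smul_left_eq_star_smul, inner_smul_right_eq_smul, conj_trivial]

theorem Test.coeFn_toHZero (ϱ : ℝ) (φ : Test H) :
    (Test.toHZero ϱ φ : ℝ → H) =ᵐ[volume] (φ : ℝ → H) :=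
  (ac_expMeasure ϱ).ae_le (memLp_test ϱ φ).coeFn_toLp

theorem hZero_ext {H : Type*} [NormedAddCommGroup H] {ϱ : ℝ} {u v : HZero ϱ H}
    (h : (u : ℝ → H) =ᵐ[volume] v) : u = v :=
  Lp.ext ((expMeasure_ac ϱ).ae_le h)

theorem coeFn_sub {H : Type*} [NormedAddCommGroup H] (ϱ : ℝ) (u v : HZero ϱ H) :
    ((u - v : HZero ϱ H) : ℝ → H) =ᵐ[volume] fun x => u x - v x :=
  (ac_expMeasure ϱ).ae_le (Lp.coeFn_sub u v)

/-- The embedding of the compactly supported smooth functions as a linear map. -/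
def Test.toHZeroLin (ϱ : ℝ) : Test H →ₗ[ℂ] HZero ϱ H where
  toFun := Test.toHZero ϱ
  map_add' u v := MemLp.toLp_add (memLp_test ϱ u) (memLp_test ϱ v)
  map_smul' c u := MemLp.toLp_const_smul c (memLp_test ϱ u)

/-- The test functions with support in `U`. -/
def Test.supportedIn (U : Set ℝ) (H : Type*) [NormedAddCommGroup H] [InnerProductSpace ℂ H] :
    Submodule ℂ (Test H) where
  carrier := {φ | tsupport (φ : ℝ → H) ⊆ U}
  zero_mem' := by simp [tsupport]
  add_mem' := fun {a b} ha hb =>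
    (tsupport_add (a : ℝ → H) (b : ℝ → H)).trans (Set.union_subset ha hb)
  smul_mem' := fun c a ha => (tsupport_smul_subset_right (fun _ => c) (a : ℝ → H)).trans ha

variable [CompleteSpace H]

/-- An element of `H_{ϱ,0}` that vanishes outside an open set `U` is a limit of test functions
supported in `U`: its component orthogonal to these test functions vanishes on `U`. -/
theorem mem_closure_test_supportedIn (ϱ : ℝ) {U : Set ℝ} (hU : IsOpen U) (x : HZero ϱ H)
    (hx : ∀ᵐ t, t ∉ U → x t = 0) :
    x ∈ closure (Test.toHZero ϱ '' {φ : Test H | tsupport (φ : ℝ → H) ⊆ U}) := by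
  set K := ((Test.supportedIn U H).map (Test.toHZeroLin ϱ)).topologicalClosure with hK
  have : CompleteSpace K := (Submodule.isClosed_topologicalClosure _).completeSpace_coe
  suffices h : x ∈ K by
    rw [hK, ← SetLike.mem_coe, Submodule.topologicalClosure_coe, Submodule.map_coe] at h
    exact h
  obtain ⟨p, hp, q, hq, rfl⟩ := K.exists_add_mem_mem_orthogonal x
  have hqU : ∀ᵐ t, t ∈ U → q t = 0 := by
    refine ae_eq_zero_of_integral_inner_smul (locallyIntegrable_coe ϱ q) hU
      fun χ h hχ hc hs => ?_
    -- the factor `exp (2 ϱ t)` cancels the weight of the inner product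
    let φ : Test H := ⟨fun t => Real.exp (2 * ϱ * t) • χ t • h,
      (by fun_prop : ContDiff ℝ ∞ fun t : ℝ => Real.exp (2 * ϱ * t)).smul
        (hχ.smul contDiff_const), hc.smul_right.smul_left⟩
    have hφU : φ ∈ Test.supportedIn U H := by
      refine Set.Subset.trans ?_ hs
      refine (tsupport_smul_subset_right (fun t => Real.exp (2 * ϱ * t))
        (fun t => χ t • h)).trans ?_
      exact tsupport_smul_subset_left χ fun _ => h
    have h1 := K.inner_left_of_mem_orthogonal
      (Submodule.le_topologicalClosure _ (Submodule.mem_map_of_mem hφU)) hq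
    rw [inner_hZero] at h1
    rw [← h1]
    refine integral_congr_ae ?_
    filter_upwards [Test.coeFn_toHZero ϱ φ] with t ht
    change _ = _ • inner ℂ (q t) ((Test.toHZero ϱ φ : ℝ → H) t)
    rw [ht]
    change _ = _ • inner ℂ (q t) (Real.exp (2 * ϱ * t) • χ t • h)
    rw [inner_smul_right_eq_smul _ (χ t • h), smul_smul, ← Real.exp_add,
      show -2 * ϱ * t + 2 * ϱ * t = 0 by ring, Real.exp_zero, one_smul]
  have hqq : inner ℂ q (p + q) = (0 : ℂ) := by
    rw [inner_hZero]
    refine integral_eq_zero_of_ae ?_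
    filter_upwards [hx, hqU] with t h1 h2
    by_cases ht : t ∈ U
    · simp [h2 ht]
    · rw [h1 ht, inner_zero_right, smul_zero, Pi.zero_apply]
  rw [inner_add_right, K.inner_left_of_mem_orthogonal hp hq, zero_add, inner_self_eq_zero] at hqq
  rw [hqq, add_zero]
  exact hp

theorem denseRange_test (ϱ : ℝ) : DenseRange (Test.toHZero (H := H) ϱ) := fun x =>
  closure_mono (Set.image_subset_range _ _)
    (mem_closure_test_supportedIn ϱ isOpen_univ x (ae_of_all _ fun _ ht => absurd trivial ht))

theorem exists_testPlus_deriv (φ : Test H) : ∃ ψ : TestPlus H, deriv (ψ : ℝ → H) = φ := by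
  obtain ⟨P, a, b, hP, hPd, hPb, -⟩ := exists_primitive φ.2.1 φ.2.2
  refine ⟨⟨P, hP, ⟨b, fun x hx => ?_⟩, 1, ?_⟩, hPd⟩
  · refine closure_minimal (fun y hy => ?_) isClosed_Iic hx
    by_contra hyb
    exact hy (hPb y (not_le.1 hyb).le)
  · rw [iteratedDeriv_one, hPd]
    exact φ.2.2

theorem derivOne_toHOne {ϱ : ℝ} (hϱ : 0 < ϱ) {ψ : TestPlus H} {φ : Test H}
    (h : deriv (ψ : ℝ → H) = φ) :
    derivOne (-ϱ) H (TestPlus.toHOne hϱ ψ) = Test.toHZero (-ϱ) φ := by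
  refine Lp.ext ?_
  refine (TestPlus.memLp hϱ (TestPlus.deriv_mem ψ.2)).coeFn_toLp.trans ?_
  rw [h]
  exact (memLp_test (-ϱ) φ).coeFn_toLp.symm

/-- The embedding of `TestPlus H` into `H_{-ϱ,1}` as a linear map. -/
def TestPlus.toHOneLin {ϱ : ℝ} (hϱ : 0 < ϱ) : TestPlus H →ₗ[ℂ] HOne (-ϱ) H where
  toFun := TestPlus.toHOne hϱ
  map_add' u v := by
    refine derivOneLin_injective (-ϱ) ?_
    rw [map_add]
    refine Lp.ext ?_
    have h1 := (TestPlus.memLp hϱ (TestPlus.deriv_mem (u + v).2)).coeFn_toLp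
    have h2 := (TestPlus.memLp hϱ (TestPlus.deriv_mem u.2)).coeFn_toLp
    have h3 := (TestPlus.memLp hϱ (TestPlus.deriv_mem v.2)).coeFn_toLp
    refine h1.trans (EventuallyEq.trans ?_ (Lp.coeFn_add _ _).symm)
    refine EventuallyEq.trans (Eq.eventuallyEq ?_) (h2.add h3).symm
    ext x
    exact deriv_add (u.2.1.differentiable (by simp) x) (v.2.1.differentiable (by simp) x)
  map_smul' c u := by
    refine derivOneLin_injective (-ϱ) ?_
    rw [map_smul]
    refine Lp.ext ?_
    have h1 := (TestPlus.memLp hϱ (TestPlus.deriv_mem (c • u).2)).coeFn_toLp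
    have h2 := (TestPlus.memLp hϱ (TestPlus.deriv_mem u.2)).coeFn_toLp
    refine h1.trans (EventuallyEq.trans ?_ (Lp.coeFn_smul _ _).symm)
    refine EventuallyEq.trans (Eq.eventuallyEq ?_) (h2.const_smul c).symm
    ext x
    exact deriv_const_smul c (u.2.1.differentiable (by simp) x)

theorem denseRange_derivOne {ϱ : ℝ} (hϱ : 0 < ϱ) :
    DenseRange fun ψ : TestPlus H => derivOne (-ϱ) H (TestPlus.toHOne hϱ ψ) := by
  refine (denseRange_test (-ϱ)).mono ?_
  rintro _ ⟨φ, rfl⟩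
  obtain ⟨ψ, hψ⟩ := exists_testPlus_deriv φ
  exact ⟨ψ, derivOne_toHOne hϱ hψ⟩

theorem denseRange_testPlus {ϱ : ℝ} (hϱ : 0 < ϱ) :
    DenseRange (TestPlus.toHOne (H := H) hϱ) := by
  intro x
  rw [(derivOne (-ϱ) H).isometry.isUniformInducing.isInducing.closure_eq_preimage_closure_image,
    Set.mem_preimage, ← Set.range_comp]
  exact denseRange_derivOne hϱ _

/-! ### The time derivative is an isometry -/

theorem timeDeriv_sub (ϱ : ℝ) (u v : HZero ϱ H) :
    timeDeriv ϱ (u - v) = timeDeriv ϱ u - timeDeriv ϱ v := by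
  simp only [timeDeriv, pairing]
  rw [map_sub, map_sub, ContinuousLinearMap.sub_comp, ContinuousLinearMap.sub_comp]

theorem timeDeriv_toHOne {ϱ : ℝ} (hϱ : 0 < ϱ) (u : HZero ϱ H) {ψ : TestPlus H} {φ : Test H}
    (h : deriv (ψ : ℝ → H) = φ) :
    timeDeriv ϱ u (TestPlus.toHOne hϱ ψ) = -∫ x, inner ℂ (u x) ((φ : ℝ → H) x) := by
  have h1 : timeDeriv ϱ u (TestPlus.toHOne hϱ ψ)
      = -pairing ϱ u (derivOne (-ϱ) H (TestPlus.toHOne hϱ ψ)) := by simp [timeDeriv]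
  rw [h1, derivOne_toHOne hϱ h, pairing_apply]
  congr 1
  refine integral_congr_ae ?_
  filter_upwards [Test.coeFn_toHZero (-ϱ) φ] with x hx
  rw [hx]

theorem norm_timeDeriv {ϱ : ℝ} (hϱ : 0 < ϱ) (u : HZero ϱ H) : ‖timeDeriv ϱ u‖ = ‖u‖ := by
  have h1 : ∀ Ψ, timeDeriv ϱ u Ψ = -pairing ϱ u (derivOne (-ϱ) H Ψ) := fun Ψ => by
    simp [timeDeriv]
  refine le_antisymm (ContinuousLinearMap.opNorm_le_bound _ (norm_nonneg _) fun Ψ => ?_) ?_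
  · rw [h1, norm_neg, ← (derivOne (-ϱ) H).norm_map Ψ]
    have h2 := norm_inner_le_norm (𝕜 := ℂ) (expMul ϱ H u) (expMul (-ϱ) H (derivOne (-ϱ) H Ψ))
    rw [(expMul ϱ H).norm_map, (expMul (-ϱ) H).norm_map] at h2
    exact h2
  -- by density the bound extends from derivatives to all of `H_{-ϱ,0}`, where the functional
  -- `pairing ϱ u` attains its norm
  · have h2 : ∀ g : HZero (-ϱ) H, ‖pairing ϱ u g‖ ≤ ‖timeDeriv ϱ u‖ * ‖g‖ := by
      refine fun g => (denseRange_derivOne hϱ).induction_on g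
        (isClosed_le (by fun_prop) (by fun_prop)) fun ψ => ?_
      rw [← norm_neg, ← h1, (derivOne (-ϱ) H).norm_map]
      exact ContinuousLinearMap.le_opNorm _ _
    have h3 := h2 ((expMul (-ϱ) H).symm (expMul ϱ H u))
    rw [(expMul (-ϱ) H).symm.norm_map, (expMul ϱ H).norm_map] at h3
    have h4 : pairing ϱ u ((expMul (-ϱ) H).symm (expMul ϱ H u))
        = inner ℂ (expMul ϱ H u) (expMul ϱ H u) := by
      change inner ℂ _ (expMul (-ϱ) H ((expMul (-ϱ) H).symm (expMul ϱ H u))) = _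
      rw [LinearIsometryEquiv.apply_symm_apply]
    rw [h4, inner_self_eq_norm_sq_to_K, (expMul ϱ H).norm_map] at h3
    rcases (norm_nonneg u).eq_or_lt with h0 | h0
    · rw [← h0]; exact norm_nonneg _
    · refine le_of_mul_le_mul_right ?_ h0
      simpa [pow_two] using h3

theorem isometry_timeDeriv {ϱ : ℝ} (hϱ : 0 < ϱ) : Isometry (timeDeriv (H := H) ϱ) :=
  Isometry.of_dist_eq fun u v => by
    rw [dist_eq_norm, dist_eq_norm, ← timeDeriv_sub, norm_timeDeriv hϱ]

theorem timeDerivInv_timeDeriv {ϱ : ℝ} (hϱ : 0 < ϱ) (u : HZero ϱ H) :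
    timeDerivInv ϱ (timeDeriv ϱ u) = u :=
  Function.leftInverse_invFun (timeDeriv_injective hϱ) u

theorem timeDeriv_timeDerivInv (ϱ : ℝ) (Λ : HNeg ϱ H) : timeDeriv ϱ (timeDerivInv ϱ Λ) = Λ :=
  Function.rightInverse_invFun (timeDeriv_surjective ϱ) Λ

theorem isometry_timeDerivInv {ϱ : ℝ} (hϱ : 0 < ϱ) : Isometry (timeDerivInv (H := H) ϱ) :=
  (isometry_timeDeriv hϱ).right_inv (timeDeriv_timeDerivInv ϱ)

/-! ### The Lipschitz continuous extension -/

/-- A map given on a dense family of points, with a Lipschitz bound, extends to a Lipschitz map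
with the same constant. -/
theorem exists_lipschitz_extend {ι X Y : Type*} [PseudoMetricSpace X] [MetricSpace Y]
    [CompleteSpace Y] {e : ι → X} (he : DenseRange e) {f : ι → Y} {K : ℝ≥0}
    (hf : ∀ i j, dist (f i) (f j) ≤ K * dist (e i) (e j)) :
    ∃ g : X → Y, LipschitzWith K g ∧ ∀ i, g (e i) = f i := by
  -- the index set carries the pseudometric that makes `e` an isometry
  let _ : PseudoMetricSpace ι := PseudoMetricSpace.induced e inferInstance
  have hu : IsUniformInducing e := ⟨rfl⟩
  have hL : LipschitzWith K f := LipschitzWith.of_dist_le_mul hf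
  set g := (hu.isDenseInducing he).extend f with hg
  have hgc : UniformContinuous g := uniformContinuous_uniformly_extend hu he hL.uniformContinuous
  have hge : ∀ i, g (e i) = f i := fun i => uniformly_extend_of_ind hu he hL.uniformContinuous i
  refine ⟨g, LipschitzWith.of_dist_le_mul fun x y => ?_, hge⟩
  refine he.induction_on₂ (p := fun x y => dist (g x) (g y) ≤ K * dist x y) ?_ ?_ x y
  · have := hgc.continuous
    exact isClosed_le (by fun_prop) (by fun_prop)
  · intro i j
    rw [hge, hge]
    exact hf i j

theorem exists_isLipschitzExtension {ϱ₀ s : ℝ} (hϱ₀ : 0 < ϱ₀) (hs : 0 ≤ s)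
    {F : Test H → (TestPlus H →ₗ[ℂ] ℂ)} (hF : PicardLindelofCondition ϱ₀ s F) {ϱ : ℝ}
    (hϱ : ϱ₀ < ϱ) :
    ∃ G, IsLipschitzExtension F ϱ G ∧ LipschitzWith s.toNNReal G := by
  have h0 : 0 < ϱ := hϱ₀.trans hϱ
  obtain ⟨K, -, hK⟩ := hF ϱ h0 hϱ
  have hd : DenseRange (TestPlus.toHOneLin (H := H) h0) := denseRange_testPlus h0
  have hb : ∀ u, ∃ C : ℝ, ∀ ψ, ‖F u ψ‖ ≤ C * ‖TestPlus.toHOneLin h0 ψ‖ := fun u => by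
    refine ⟨K + s * ‖Test.toHZero ϱ u‖, fun ψ => ?_⟩
    obtain ⟨h1, h2⟩ := hK u 0 ψ
    rw [sub_zero] at h2
    change _ ≤ _ * ‖TestPlus.toHOne h0 ψ‖
    calc ‖F u ψ‖ = ‖F 0 ψ + (F u ψ - F 0 ψ)‖ := by congr 1; ring
      _ ≤ ‖F 0 ψ‖ + ‖F u ψ - F 0 ψ‖ := norm_add_le _ _
      _ ≤ _ := by nlinarith
  have hfe : ∀ u ψ, (F u).extendOfNorm (TestPlus.toHOneLin h0) (TestPlus.toHOne h0 ψ) = F u ψ :=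
    fun u ψ => LinearMap.extendOfNorm_eq hd (hb u) ψ
  obtain ⟨G, hG, hGe⟩ := exists_lipschitz_extend (denseRange_test (H := H) ϱ)
    (f := fun u => ((F u).extendOfNorm (TestPlus.toHOneLin h0) : HNeg ϱ H)) (K := s.toNNReal) (by
      intro u w
      rw [dist_eq_norm, dist_eq_norm, Real.coe_toNNReal _ hs]
      refine ContinuousLinearMap.opNorm_le_bound _ (by positivity) fun Ψ => ?_
      refine (denseRange_testPlus h0).induction_on Ψ
        (isClosed_le (by fun_prop) (by fun_prop)) fun ψ => ?_
      rw [sub_apply, hfe, hfe]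
      have h1 := (hK u w ψ).2
      have h2 : Test.toHZero ϱ (u - w) = Test.toHZero ϱ u - Test.toHZero ϱ w :=
        (Test.toHZeroLin ϱ).map_sub u w
      rw [h2] at h1
      linarith)
  exact ⟨G, ⟨⟨_, hG⟩, fun _ u ψ => by rw [hGe]; exact hfe u ψ⟩, hG⟩

theorem IsLipschitzExtension.unique {F : Test H → (TestPlus H →ₗ[ℂ] ℂ)} {ϱ : ℝ} (hϱ : 0 < ϱ)
    {G G' : HZero ϱ H → HNeg ϱ H} (h : IsLipschitzExtension F ϱ G)
    (h' : IsLipschitzExtension F ϱ G') : G = G' := by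
  obtain ⟨⟨K, hK⟩, h1⟩ := h
  obtain ⟨⟨K', hK'⟩, h1'⟩ := h'
  refine (denseRange_test ϱ).equalizer hK.continuous hK'.continuous (funext fun u => ?_)
  refine DFunLike.coe_injective ((denseRange_testPlus hϱ).equalizer (map_continuous _)
    (map_continuous _) (funext fun ψ => ?_))
  exact (h1 hϱ u ψ).trans (h1' hϱ u ψ).symm

theorem isLipschitzExtension_lipExtension {ϱ₀ s : ℝ} (hϱ₀ : 0 < ϱ₀) (hs : 0 ≤ s)
    {F : Test H → (TestPlus H →ₗ[ℂ] ℂ)} (hF : PicardLindelofCondition ϱ₀ s F) {ϱ : ℝ}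
    (hϱ : ϱ₀ < ϱ) : IsLipschitzExtension F ϱ (lipExtension F ϱ) := by
  have h : ∃ G, IsLipschitzExtension F ϱ G :=
    (exists_isLipschitzExtension hϱ₀ hs hF hϱ).imp fun _ h => h.1
  rw [lipExtension, dif_pos h]
  exact h.choose_spec

theorem lipschitzWith_lipExtension {ϱ₀ s : ℝ} (hϱ₀ : 0 < ϱ₀) (hs : 0 ≤ s)
    {F : Test H → (TestPlus H →ₗ[ℂ] ℂ)} (hF : PicardLindelofCondition ϱ₀ s F) {ϱ : ℝ}
    (hϱ : ϱ₀ < ϱ) : LipschitzWith s.toNNReal (lipExtension F ϱ) := by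
  obtain ⟨G, hG, hL⟩ := exists_isLipschitzExtension hϱ₀ hs hF hϱ
  rwa [(isLipschitzExtension_lipExtension hϱ₀ hs hF hϱ).unique (hϱ₀.trans hϱ) hG]

/-! ### Causality from uniform Lipschitz bounds for large weights -/

/-- Elements of spaces with different weights that agree as functionals on test functions coincide
almost everywhere. -/
theorem ae_eq_of_integral_inner_test (ν ϱ : ℝ) (f : HZero ν H) (g : HZero ϱ H)
    (h : ∀ (χ : ℝ → ℝ) (v : H), ContDiff ℝ ∞ χ → HasCompactSupport χ →
      ∫ x, inner ℂ (f x) (χ x • v) = ∫ x, inner ℂ (g x) (χ x • v)) :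
    (f : ℝ → H) =ᵐ[volume] g := by
  have hf := locallyIntegrable_coe ν f
  have hg := locallyIntegrable_coe ϱ g
  have hi : ∀ {f : ℝ → H}, LocallyIntegrable f volume → ∀ (χ : ℝ → ℝ) (v : H), ContDiff ℝ ∞ χ →
      HasCompactSupport χ → Integrable (fun x => inner ℂ (f x) (χ x • v)) volume := by
    intro f hf χ v hχ hc
    refine ((integrable_test_smul hχ.continuous hc hf).inner_const (𝕜 := ℂ) v).congr
      (ae_of_all _ fun x => ?_)
    simp only
    rw [inner_smul_left_eq_star_smul, inner_smul_right_eq_smul, conj_trivial]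
  have h1 : ∀ᵐ x, x ∈ Set.univ → f x - g x = 0 := by
    refine ae_eq_zero_of_integral_inner_smul (f := fun x => f x - g x) (hf.sub hg) isOpen_univ
      fun χ v hχ hc _ => ?_
    simp_rw [inner_sub_left]
    rw [integral_sub (hi hf χ v hχ hc) (hi hg χ v hχ hc), h χ v hχ hc, sub_self]
  filter_upwards [h1] with x hx
  exact sub_eq_zero.1 (hx trivial)

theorem norm_sq_hZero (ϱ : ℝ) (u : HZero ϱ H) :
    ‖u‖ ^ 2 = ∫ x, Real.exp (-2 * ϱ * x) * ‖u x‖ ^ 2 := by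
  have h := inner_hZero ϱ u u
  have h2 : (fun x => Real.exp (-2 * ϱ * x) • inner ℂ (u x) (u x))
      = fun x => ((Real.exp (-2 * ϱ * x) * ‖u x‖ ^ 2 : ℝ) : ℂ) := by
    ext x
    rw [inner_self_eq_norm_sq_to_K]
    simp
  rw [inner_self_eq_norm_sq_to_K, h2, integral_complex_ofReal] at h
  exact Complex.ofReal_injective (by simpa using h)

theorem integrable_norm_sq_hZero (ϱ : ℝ) (u : HZero ϱ H) :
    Integrable (fun x => Real.exp (-2 * ϱ * x) * ‖u x‖ ^ 2) volume := by
  have h := (memLp_exp_smul ϱ u).integrable_norm_pow (by norm_num)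
  refine h.congr (ae_of_all _ fun x => ?_)
  simp only [norm_smul, Real.norm_of_nonneg (Real.exp_pos _).le, mul_pow]
  rw [← Real.exp_nat_mul]
  congr 2
  push_cast
  ring

/-- Truncation to `(-∞, a)`, that is, multiplication by the indicator function of `(-∞, a)`. -/
def truncate {ϱ : ℝ} (a : ℝ) (u : HZero ϱ H) : HZero ϱ H :=
  ((Lp.memLp u).indicator (s := Set.Iio a) measurableSet_Iio).toLp

theorem coeFn_truncate {ϱ : ℝ} (a : ℝ) (u : HZero ϱ H) :
    (truncate a u : ℝ → H) =ᵐ[volume] (Set.Iio a).indicator u :=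
  (ac_expMeasure ϱ).ae_le (MemLp.coeFn_toLp _)

theorem truncate_eq_iff {ϱ : ℝ} (a : ℝ) (u v : HZero ϱ H) :
    truncate a u = truncate a v ↔ AgreeBefore a u v := by
  constructor
  · intro h
    have h1 := coeFn_truncate a v
    rw [← h] at h1
    filter_upwards [coeFn_truncate a u, h1] with t h2 h3 ht
    rw [h2] at h3
    simpa [ht] using h3
  · intro h
    refine hZero_ext ?_
    filter_upwards [h, coeFn_truncate a u, coeFn_truncate a v] with t h1 h2 h3
    rw [h2, h3]
    by_cases ht : t < a
    · simp [ht, h1 ht]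
    · simp [ht]

theorem norm_truncate_le {ϱ : ℝ} (a : ℝ) (u : HZero ϱ H) : ‖truncate a u‖ ≤ ‖u‖ := by
  refine Lp.norm_le_norm_of_ae_le ((expMeasure_ac ϱ).ae_le ?_)
  filter_upwards [coeFn_truncate a u] with t ht
  rw [ht]
  exact norm_indicator_le_norm_self _ _

theorem truncate_sub {ϱ : ℝ} (a : ℝ) (u v : HZero ϱ H) :
    truncate a (u - v) = truncate a u - truncate a v := by
  refine hZero_ext ?_
  filter_upwards [coeFn_truncate a u, coeFn_truncate a v, coeFn_truncate a (u - v),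
    coeFn_sub ϱ u v, coeFn_sub ϱ (truncate a u) (truncate a v)] with t h1 h2 h3 h4 h5
  rw [h5, h1, h2, h3]
  by_cases ht : t < a
  · simp only [Set.indicator_of_mem (Set.mem_Iio.2 ht), h4]
  · simp [ht]

theorem continuous_truncate {ϱ : ℝ} (a : ℝ) : Continuous (truncate (H := H) (ϱ := ϱ) a) :=
  (LipschitzWith.of_dist_le_mul (K := 1) fun u v => by
    rw [dist_eq_norm, dist_eq_norm, ← truncate_sub, NNReal.coe_one, one_mul]
    exact norm_truncate_le a _).continuous

/-- Raising the weight from `ϱ` to `ν` increases the norm of the part of `u` before `b` by the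
factor `exp (-(ν - ϱ) b)` at least. -/
theorem norm_truncate_le_of_weight {ϱ ν : ℝ} (h : ϱ ≤ ν) (b : ℝ) (u : HZero ϱ H) (w : HZero ν H)
    (huw : (w : ℝ → H) =ᵐ[volume] u) :
    ‖truncate b u‖ ≤ Real.exp ((ν - ϱ) * b) * ‖w‖ := by
  refine le_of_sq_le_sq ?_ (by positivity)
  rw [mul_pow, norm_sq_hZero, norm_sq_hZero, ← integral_const_mul]
  refine integral_mono_ae (integrable_norm_sq_hZero ϱ _)
    ((integrable_norm_sq_hZero ν w).const_mul _) ?_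
  filter_upwards [coeFn_truncate b u, huw] with t h1 h2
  rw [h1, h2]
  by_cases ht : t < b
  · rw [Set.indicator_of_mem (Set.mem_Iio.2 ht), ← mul_assoc, ← Real.exp_nat_mul, ← Real.exp_add]
    gcongr
    push_cast
    nlinarith
  · rw [Set.indicator_of_notMem (by simpa using ht)]
    rw [norm_zero, zero_pow two_ne_zero, mul_zero]
    positivity

/-- A test function supported in `(a, ∞)` has a norm that decays like `exp (-(ν - ϱ) a)` as the
weight `ν` grows. -/
theorem Test.norm_toHZero_le {ϱ ν : ℝ} (h : ϱ ≤ ν) {a : ℝ} (φ : Test H)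
    (hφ : tsupport (φ : ℝ → H) ⊆ Set.Ioi a) :
    ‖Test.toHZero ν φ‖ ≤ Real.exp (-(ν - ϱ) * a) * ‖Test.toHZero ϱ φ‖ := by
  refine le_of_sq_le_sq ?_ (by positivity)
  rw [mul_pow, norm_sq_hZero, norm_sq_hZero, ← integral_const_mul]
  refine integral_mono_ae (integrable_norm_sq_hZero ν _)
    ((integrable_norm_sq_hZero ϱ _).const_mul _) ?_
  filter_upwards [Test.coeFn_toHZero ν φ, Test.coeFn_toHZero ϱ φ] with t h1 h2
  rw [h1, h2]
  by_cases ht : a < t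
  · rw [← mul_assoc, ← Real.exp_nat_mul, ← Real.exp_add]
    gcongr
    push_cast
    nlinarith
  · rw [image_eq_zero_of_notMem_tsupport fun h => ht (hφ h)]
    simp

/-- A function whose norms decay like `exp (-(ν - ϱ) a)` as the weight `ν` grows vanishes
before `a`. -/
theorem agreeBefore_zero_of_norm_le {ϱ a C : ℝ} (u : HZero ϱ H)
    (h : ∀ ν, ϱ ≤ ν → ∃ w : HZero ν H, (w : ℝ → H) =ᵐ[volume] u ∧
      ‖w‖ ≤ C * Real.exp (-(ν - ϱ) * a)) :
    ∀ᵐ t, t < a → u t = 0 := by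
  have key : ∀ b < a, ∀ᵐ t, t < b → u t = 0 := by
    intro b hb
    have h1 : ∀ μ : ℝ, 0 ≤ μ → ‖truncate b u‖ ≤ C * Real.exp (-((a - b) * μ)) := by
      intro μ hμ
      obtain ⟨w, hw, hwn⟩ := h (ϱ + μ) (by linarith)
      refine (norm_truncate_le_of_weight (by linarith) b u w hw).trans ?_
      calc _ ≤ Real.exp ((ϱ + μ - ϱ) * b) * (C * Real.exp (-(ϱ + μ - ϱ) * a)) := by gcongr
        _ = C * (Real.exp ((ϱ + μ - ϱ) * b) * Real.exp (-(ϱ + μ - ϱ) * a)) := by ring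
        _ = _ := by rw [← Real.exp_add]; ring_nf
    have h2 : Tendsto (fun μ : ℝ => C * Real.exp (-((a - b) * μ))) atTop (𝓝 (C * 0)) :=
      (Real.tendsto_exp_neg_atTop_nhds_zero.comp
        (tendsto_id.const_mul_atTop (sub_pos.2 hb))).const_mul C
    rw [mul_zero] at h2
    have h3 : truncate b u = 0 := norm_le_zero_iff.1
      (ge_of_tendsto h2 ((eventually_ge_atTop 0).mono h1))
    have h4 := coeFn_truncate b u
    rw [h3] at h4
    filter_upwards [h4, (ac_expMeasure ϱ).ae_le (Lp.coeFn_zero H 2 (expMeasure ϱ))] with t h5 h6 ht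
    rw [h6, Set.indicator_of_mem (Set.mem_Iio.2 ht)] at h5
    exact h5.symm
  have h2 : ∀ᵐ t, ∀ n : ℕ, t < a - 1 / ((n : ℝ) + 1) → u t = 0 :=
    ae_all_iff.2 fun n => key _ (sub_lt_self a (by positivity))
  filter_upwards [h2] with t ht hta
  obtain ⟨n, hn⟩ := exists_nat_one_div_lt (sub_pos.2 hta)
  exact ht n (by linarith)

/-- Continuous operators that are given on test functions by one map, independently of the weight,
and satisfy a Lipschitz bound uniformly for large weights, are causal. -/
theorem isCausal_of_uniform_lipschitz {ϱ : ℝ} (S : ∀ ν, HZero ν H → HZero ν H) {C : ℝ≥0}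
    (hL : ∀ ν, ϱ ≤ ν → LipschitzWith C (S ν))
    (hS : ∀ ν, ϱ ≤ ν → ∀ φ : Test H,
      (S ν (Test.toHZero ν φ) : ℝ → H) =ᵐ[volume] S ϱ (Test.toHZero ϱ φ)) :
    IsCausal (S ϱ) := by
  have hc := (hL ϱ le_rfl).continuous
  intro a x y hxy
  have htest : ∀ φ χ : Test H, tsupport (χ : ℝ → H) ⊆ Set.Ioi a →
      AgreeBefore a (S ϱ (Test.toHZero ϱ φ)) (S ϱ (Test.toHZero ϱ φ - Test.toHZero ϱ χ)) := by
    intro φ χ hχ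
    have hsub : ∀ ν, Test.toHZero ν φ - Test.toHZero ν χ = Test.toHZero ν (φ - χ) := fun ν =>
      ((Test.toHZeroLin ν).map_sub φ χ).symm
    rw [hsub]
    have h1 := agreeBefore_zero_of_norm_le (a := a) (C := C * ‖Test.toHZero ϱ χ‖)
      (S ϱ (Test.toHZero ϱ φ) - S ϱ (Test.toHZero ϱ (φ - χ))) (by
        intro ν hν
        refine ⟨S ν (Test.toHZero ν φ) - S ν (Test.toHZero ν (φ - χ)), ?_, ?_⟩
        · filter_upwards [hS ν hν φ, hS ν hν (φ - χ),
            coeFn_sub ν (S ν (Test.toHZero ν φ)) (S ν (Test.toHZero ν (φ - χ))),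
            coeFn_sub ϱ (S ϱ (Test.toHZero ϱ φ)) (S ϱ (Test.toHZero ϱ (φ - χ)))]
            with t e1 e2 e3 e4
          rw [e3, e4, e1, e2]
        · rw [← dist_eq_norm]
          refine ((hL ν hν).dist_le_mul _ _).trans ?_
          rw [← hsub, dist_eq_norm, sub_sub_cancel, mul_assoc, mul_comm ‖_‖]
          gcongr
          exact Test.norm_toHZero_le hν χ hχ)
    filter_upwards [h1, coeFn_sub ϱ (S ϱ (Test.toHZero ϱ φ)) (S ϱ (Test.toHZero ϱ (φ - χ)))]
      with t e1 e2 ht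
    exact sub_eq_zero.1 (e2.symm.trans (e1 ht))
  -- `x` and `x - y` are approximated separately, the latter by test functions supported in
  -- `(a, ∞)`, so that the approximations of `x` and `y` still agree before `a`
  have hcl : IsClosed {p : HZero ϱ H × HZero ϱ H |
      truncate a (S ϱ p.1) = truncate a (S ϱ (p.1 - p.2))} := by
    have := continuous_truncate (H := H) (ϱ := ϱ) a
    exact isClosed_eq (by fun_prop) (by fun_prop)
  have hd : x - y ∈ closure
      (Test.toHZero ϱ '' {φ : Test H | tsupport (φ : ℝ → H) ⊆ Set.Ioi a}) := by
    refine mem_closure_test_supportedIn ϱ isOpen_Ioi _ ?_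
    filter_upwards [hxy, coeFn_sub ϱ x y, Measure.ae_ne volume a] with t h1 h2 h3 h4
    rw [h2, h1 (lt_of_le_of_ne (not_lt.1 h4) h3), sub_self]
  have hmem : (x, x - y) ∈ closure (Set.range (Test.toHZero ϱ) ×ˢ
      (Test.toHZero ϱ '' {φ : Test H | tsupport (φ : ℝ → H) ⊆ Set.Ioi a})) := by
    rw [closure_prod_eq]
    exact ⟨denseRange_test ϱ x, hd⟩
  have h := closure_minimal (t := {p : HZero ϱ H × HZero ϱ H |
      truncate a (S ϱ p.1) = truncate a (S ϱ (p.1 - p.2))}) (by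
    rintro ⟨_, _⟩ ⟨⟨φ, rfl⟩, χ, hχ, rfl⟩
    exact (truncate_eq_iff a _ _).2 (htest φ χ hχ)) hcl hmem
  rw [Set.mem_ofPred_eq, sub_sub_cancel] at h
  exact (truncate_eq_iff a _ _).1 h

theorem IsCausal.comp {ϱ : ℝ} {V W : HZero ϱ H → HZero ϱ H} (hV : IsCausal V) (hW : IsCausal W) :
    IsCausal (V ∘ W) := fun a x y h => hV a _ _ (hW a x y h)

/-- The functions `∂_{0,ϱ}⁻¹ F_ϱ(φ)` for test functions `φ` do not depend on the weight, since
every test function is the derivative of an element of `TestPlus H`. -/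
theorem timeDerivInv_lipExtension_test {ϱ₀ s : ℝ} (hϱ₀ : 0 < ϱ₀) (hs : 0 ≤ s)
    {F : Test H → (TestPlus H →ₗ[ℂ] ℂ)} (hF : PicardLindelofCondition ϱ₀ s F) {ϱ ν : ℝ}
    (hϱ : ϱ₀ < ϱ) (hν : ϱ₀ < ν) (φ : Test H) :
    (timeDerivInv ν (lipExtension F ν (Test.toHZero ν φ)) : ℝ → H) =ᵐ[volume]
      timeDerivInv ϱ (lipExtension F ϱ (Test.toHZero ϱ φ)) := by
  have key : ∀ μ, ϱ₀ < μ → ∀ (ψ : TestPlus H) (χ : Test H), deriv (ψ : ℝ → H) = χ →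
      ∫ x, inner ℂ (timeDerivInv μ (lipExtension F μ (Test.toHZero μ φ)) x) ((χ : ℝ → H) x)
        = -F φ ψ := by
    intro μ hμ ψ χ h
    have h0 := hϱ₀.trans hμ
    rw [← neg_eq_iff_eq_neg, ← timeDeriv_toHOne h0 _ h, timeDeriv_timeDerivInv]
    exact (isLipschitzExtension_lipExtension hϱ₀ hs hF hμ).2 h0 φ ψ
  set f := timeDerivInv ν (lipExtension F ν (Test.toHZero ν φ))
  set g := timeDerivInv ϱ (lipExtension F ϱ (Test.toHZero ϱ φ))
  exact ae_eq_of_integral_inner_test ν ϱ f g fun χ v hχ hc => by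
    let χ' : Test H := ⟨fun x => χ x • v, hχ.smul contDiff_const, hc.smul_right⟩
    obtain ⟨ψ, hψ⟩ := exists_testPlus_deriv χ'
    exact (key ν hν ψ χ' hψ).trans (key ϱ hϱ ψ χ' hψ).symm

theorem isCausal_timeDerivInv_lipExtension {ϱ₀ s : ℝ} (hϱ₀ : 0 < ϱ₀) (hs : 0 ≤ s)
    {F : Test H → (TestPlus H →ₗ[ℂ] ℂ)} (hF : PicardLindelofCondition ϱ₀ s F) {ϱ : ℝ}
    (hϱ : ϱ₀ < ϱ) : IsCausal fun x => timeDerivInv ϱ (lipExtension F ϱ x) := by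
  refine isCausal_of_uniform_lipschitz (fun ν x => timeDerivInv ν (lipExtension F ν x))
    (C := 1 * s.toNNReal) (fun ν hν => ?_) fun ν hν φ => ?_
  · exact (isometry_timeDerivInv (hϱ₀.trans (hϱ.trans_le hν))).lipschitz.comp
      (lipschitzWith_lipExtension hϱ₀ hs hF (hϱ.trans_le hν))
  · exact timeDerivInv_lipExtension_test hϱ₀ hs hF hϱ (hϱ.trans_le hν) φ

/-! ### Shifting a vertical line of integration -/

/-- The integral of a holomorphic function over a vertical line does not change when the line is
moved inside a strip on which the function decays like `1 / (1 + (Im z)²)`. -/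
theorem integral_vertical_line_eq {g : ℂ → ℂ} {a b K : ℝ} (hab : a ≤ b)
    (hd : ∀ z : ℂ, a ≤ z.re → z.re ≤ b → DifferentiableAt ℂ g z)
    (hK : ∀ z : ℂ, a ≤ z.re → z.re ≤ b → ‖g z‖ ≤ K * (1 + z.im ^ 2)⁻¹) :
    ∫ t : ℝ, g (a + t * Complex.I) = ∫ t : ℝ, g (b + t * Complex.I) := by
  have hint : ∀ c : ℝ, a ≤ c → c ≤ b → Integrable (fun t : ℝ => g (c + t * Complex.I)) := by
    intro c h1 h2
    have hc : Continuous fun t : ℝ => g (c + t * Complex.I) := by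
      refine continuous_iff_continuousAt.2 fun t => ?_
      exact ContinuousAt.comp (g := g) (hd _ (by simpa using h1) (by simpa using h2)).continuousAt
        (by fun_prop)
    refine (integrable_inv_one_add_sq.const_mul K).mono' hc.aestronglyMeasurable
      (ae_of_all _ fun t => ?_)
    simpa using hK (c + t * Complex.I) (by simpa using h1) (by simpa using h2)
  have hlim : ∀ c : ℝ, a ≤ c → c ≤ b → Tendsto (fun T : ℝ => ∫ y : ℝ in (-T)..T,
      g (c + y * Complex.I)) atTop (𝓝 (∫ t : ℝ, g (c + t * Complex.I))) := fun c h1 h2 =>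
    intervalIntegral_tendsto_integral (hint c h1 h2) tendsto_neg_atTop_atBot tendsto_id
  have hhor : ∀ s : ℝ → ℝ, (∀ T, s T ^ 2 = T ^ 2) → Tendsto (fun T : ℝ => ∫ x : ℝ in a..b,
      g (x + (s T : ℝ) * Complex.I)) atTop (𝓝 0) := by
    intro s hs
    have hb : ∀ T : ℝ, ‖∫ x : ℝ in a..b, g (x + (s T : ℝ) * Complex.I)‖
        ≤ K * (1 + T ^ 2)⁻¹ * |b - a| := by
      intro T
      refine intervalIntegral.norm_integral_le_of_norm_le_const fun x hx => ?_
      rw [Set.uIoc_of_le hab] at hx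
      have := hK (x + (s T : ℝ) * Complex.I) (by simpa using hx.1.le) (by simpa using hx.2)
      simpa [hs T] using this
    refine squeeze_zero_norm hb ?_
    have h1 : Tendsto (fun T : ℝ => (1 + T ^ 2)⁻¹) atTop (𝓝 0) :=
      tendsto_inv_atTop_zero.comp
        (tendsto_atTop_add_const_left _ _ (tendsto_pow_atTop two_ne_zero))
    simpa using (h1.const_mul K).mul_const |b - a|
  have hrect : ∀ T : ℝ, (∫ x : ℝ in a..b, g (x + ((-T : ℝ) : ℂ) * Complex.I))
      - (∫ x : ℝ in a..b, g (x + ((T : ℝ) : ℂ) * Complex.I))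
      + Complex.I • (∫ y : ℝ in (-T)..T, g (b + y * Complex.I))
      - Complex.I • (∫ y : ℝ in (-T)..T, g (a + y * Complex.I)) = 0 := by
    intro T
    refine Complex.integral_boundary_rect_eq_zero_of_differentiableOn g ⟨a, -T⟩ ⟨b, T⟩
      fun z hz => ?_
    rw [Complex.mem_reProdIm, Set.uIcc_of_le hab] at hz
    exact (hd z hz.1.1 hz.1.2).differentiableWithinAt
  have h0 := (((hhor (fun T => -T) fun T => by ring).sub (hhor (fun T => T) fun T => rfl)).add
    ((hlim b hab le_rfl).const_smul Complex.I)).sub ((hlim a le_rfl hab).const_smul Complex.I)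
  simp_rw [hrect] at h0
  have h1 := tendsto_nhds_unique h0 tendsto_const_nhds
  rw [sub_zero, zero_add, ← smul_sub, smul_eq_zero, sub_eq_zero] at h1
  exact (h1.resolve_left Complex.I_ne_zero).symm

/-! ### The Laplace transform of a compactly supported function -/

section laplace

variable {E : Type*} [NormedAddCommGroup E] [NormedSpace ℂ E]

/-- The two-sided Laplace transform `z ↦ ∫ exp (-z x) f x dx`. -/
def laplace (f : ℝ → E) (z : ℂ) : E := ∫ x : ℝ, Complex.exp (-z * x) • f x

theorem integrable_laplace {f : ℝ → E} (hf : Continuous f) (hc : HasCompactSupport f) (z : ℂ) :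
    Integrable fun x : ℝ => Complex.exp (-z * x) • f x :=
  ((by fun_prop : Continuous fun x : ℝ => Complex.exp (-z * x)).smul
    hf).integrable_of_hasCompactSupport hc.smul_left

theorem norm_exp_neg_mul_le {z : ℂ} {R : ℝ} (hz : |z.re| ≤ R) (x : ℝ) :
    ‖Complex.exp (-z * x)‖ ≤ Real.exp (R * |x|) := by
  rw [Complex.norm_exp]
  refine Real.exp_le_exp.2 ?_
  have h1 : (-z * x).re = -(z.re * x) := by simp
  rw [h1]
  calc -(z.re * x) ≤ |z.re * x| := neg_le_abs _
    _ = |z.re| * |x| := abs_mul _ _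
    _ ≤ R * |x| := by gcongr

theorem norm_laplace_le {f : ℝ → E} (hf : Continuous f) (hc : HasCompactSupport f) {z : ℂ} {R : ℝ}
    (hz : |z.re| ≤ R) : ‖laplace f z‖ ≤ ∫ x : ℝ, Real.exp (R * |x|) * ‖f x‖ := by
  refine norm_integral_le_of_norm_le
    (((by fun_prop : Continuous fun x : ℝ => Real.exp (R * |x|)).mul
      hf.norm).integrable_of_hasCompactSupport hc.norm.mul_left) (ae_of_all _ fun x => ?_)
  rw [norm_smul]
  gcongr
  exact norm_exp_neg_mul_le hz x

theorem differentiableAt_laplace [CompleteSpace E] {f : ℝ → E} (hf : Continuous f)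
    (hc : HasCompactSupport f) (z : ℂ) : DifferentiableAt ℂ (laplace f) z := by
  have hF' : ∀ w : ℂ, Continuous fun x : ℝ => (Complex.exp (-w * x) * (-(x : ℂ))) • f x := fun w =>
    (by fun_prop : Continuous fun x : ℝ => Complex.exp (-w * x) * (-(x : ℂ))).smul hf
  refine (hasDerivAt_integral_of_dominated_loc_of_deriv_le (𝕜 := ℂ)
    (F := fun w (x : ℝ) => Complex.exp (-w * x) • f x)
    (F' := fun w (x : ℝ) => (Complex.exp (-w * x) * (-(x : ℂ))) • f x)
    (bound := fun x => Real.exp ((‖z‖ + 1) * |x|) * |x| * ‖f x‖)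
    (Metric.ball_mem_nhds z one_pos)
    (Eventually.of_forall fun w => (integrable_laplace hf hc w).aestronglyMeasurable)
    (integrable_laplace hf hc z) (hF' z).aestronglyMeasurable
    (ae_of_all _ fun x w hw => ?_) ?_ (ae_of_all _ fun x w _ => ?_)).2.differentiableAt
  · rw [norm_smul, norm_mul, norm_neg, Complex.norm_real, Real.norm_eq_abs]
    gcongr
    refine norm_exp_neg_mul_le ((Complex.abs_re_le_norm w).trans ?_) x
    have h1 := norm_le_norm_add_norm_sub z w
    rw [mem_ball_iff_norm'] at hw
    linarith
  · exact ((by fun_prop : Continuous fun x : ℝ => Real.exp ((‖z‖ + 1) * |x|) * |x|).mul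
      hf.norm).integrable_of_hasCompactSupport hc.norm.mul_left
  · have h1 : HasDerivAt (fun w : ℂ => -w * x) (-(x : ℂ)) w := by
      simpa using (hasDerivAt_id w).neg.mul_const (x : ℂ)
    exact h1.cexp.smul_const (f x)

/-- Integration by parts: the Laplace transform of the derivative is the Laplace transform
multiplied by `z`. -/
theorem laplace_deriv [CompleteSpace E] {f : ℝ → E} (hf : ContDiff ℝ ∞ f)
    (hc : HasCompactSupport f) (z : ℂ) : laplace (deriv f) z = z • laplace f z := by
  have hd : Continuous (deriv f) := hf.continuous_deriv (by simp)
  have i1 := integrable_laplace hf.continuous hc z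
  have i2 := integrable_laplace hd hc.deriv z
  have h : ∫ x : ℝ,
      (Complex.exp (-z * x) • deriv f x + (Complex.exp (-z * x) * (-z)) • f x) = 0 := by
    refine integral_eq_zero_of_hasDerivAt_of_integrable
      (f := fun x : ℝ => Complex.exp (-z * x) • f x)
      (fun x => ?_) (i2.add ((i1.smul (-z)).congr (ae_of_all _ fun x => ?_))) i1
    · have h1 : HasDerivAt (fun x : ℝ => -z * (x : ℂ)) (-z) x := by
        simpa using (Complex.ofRealCLM.hasDerivAt (x := x)).const_mul (-z)
      exact h1.cexp.smul (hf.differentiable (by simp) x).hasDerivAt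
    · simp only [Pi.smul_apply, smul_smul, mul_comm]
  have h2 : ∀ x : ℝ, (Complex.exp (-z * x) * (-z)) • f x = (-z) • Complex.exp (-z * x) • f x :=
    fun x => by rw [smul_smul, mul_comm]
  simp_rw [h2] at h
  have i3 : Integrable fun x : ℝ => (-z) • Complex.exp (-z * x) • f x := i1.smul (-z)
  rw [integral_add i2 i3, integral_smul, neg_smul, ← sub_eq_add_neg, sub_eq_zero] at h
  exact h

theorem norm_laplace_mul_le [CompleteSpace E] {f : ℝ → E} (hf : ContDiff ℝ ∞ f)
    (hc : HasCompactSupport f) (R : ℝ) :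
    ∃ B : ℝ, 0 ≤ B ∧ ∀ z : ℂ, |z.re| ≤ R → ‖z‖ * ‖laplace f z‖ ≤ B :=
  ⟨_, integral_nonneg fun x => mul_nonneg (Real.exp_pos (R * |x|)).le (norm_nonneg (deriv f x)),
    fun z hz => by
    rw [← norm_smul, ← laplace_deriv hf hc]
    exact norm_laplace_le (hf.continuous_deriv (by simp)) hc.deriv hz⟩

theorem conj_laplace (χ : ℝ → ℝ) (z : ℂ) :
    (starRingEnd ℂ) (laplace (fun x => (χ x : ℂ)) z)
      = laplace (fun x => (χ x : ℂ)) ((starRingEnd ℂ) z) := by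
  rw [laplace, ← integral_conj]
  refine integral_congr_ae (ae_of_all _ fun x => ?_)
  simp [← Complex.exp_conj]

end laplace

/-! ### Bounded analytic functions of `∂_{0,ϱ}⁻¹` -/

theorem inv_mem_ball {r : ℝ} (hr : 0 < r) {z : ℂ} (hz : 1 / (2 * r) < z.re) :
    1 / z ∈ Metric.ball (r : ℂ) r := by
  have h0 : 0 < z.re := lt_trans (by positivity) hz
  have hz0 : z ≠ 0 := fun h => by simp [h] at h0
  -- `|1 - r z| < r |z|` is equivalent to `1 < 2 r Re z`
  have h1 : 1 / z - r = (1 - r * z) / z := by field_simp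
  rw [mem_ball_iff_norm, h1, norm_div, div_lt_iff₀ (norm_pos_iff.2 hz0)]
  refine lt_of_pow_lt_pow_left₀ 2 (by positivity) ?_
  rw [mul_pow, ← Complex.normSq_eq_norm_sq, ← Complex.normSq_eq_norm_sq, Complex.normSq_apply,
    Complex.normSq_apply]
  rw [div_lt_iff₀ (by positivity)] at hz
  simp
  nlinarith

variable {r : ℝ} {M : ℂ → H →L[ℂ] H}

theorem differentiableAt_comp_inv (hr : 0 < r) (hM : AnalyticOnNhd ℂ M (Metric.ball (r : ℂ) r))
    {z : ℂ} (hz : 1 / (2 * r) < z.re) : DifferentiableAt ℂ (fun z => M (1 / z)) z := by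
  have hz0 : z ≠ 0 := fun h => by
    have : (0 : ℝ) < 1 / (2 * r) := by positivity
    rw [h, Complex.zero_re] at hz
    linarith
  exact DifferentiableAt.comp z (g := M) (hM _ (inv_mem_ball hr hz)).differentiableAt
    ((differentiableAt_const (1 : ℂ)).div differentiableAt_id hz0)

/-- The point `2 π i ξ + ϱ` on the vertical line through `ϱ`. -/
def spectralPoint (ϱ ξ : ℝ) : ℂ := Complex.I * ((2 * Real.pi * ξ : ℝ) : ℂ) + (ϱ : ℂ)

theorem spectralPoint_re (ϱ ξ : ℝ) : (spectralPoint ϱ ξ).re = ϱ := by simp [spectralPoint]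

theorem continuous_symbol (hr : 0 < r) (hM : AnalyticOnNhd ℂ M (Metric.ball (r : ℂ) r)) {ϱ : ℝ}
    (hϱ : 1 / (2 * r) < ϱ) : Continuous fun ξ => M (1 / spectralPoint ϱ ξ) := by
  refine continuous_iff_continuousAt.2 fun ξ => ?_
  refine ContinuousAt.comp (g := fun z => M (1 / z)) (f := spectralPoint ϱ)
    (differentiableAt_comp_inv hr hM (by rwa [spectralPoint_re])).continuousAt ?_
  unfold spectralPoint
  fun_prop

theorem norm_symbol_le (hr : 0 < r) {C : ℝ} (hC : ∀ z ∈ Metric.ball (r : ℂ) r, ‖M z‖ ≤ C) {ϱ : ℝ}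
    (hϱ : 1 / (2 * r) < ϱ) (ξ : ℝ) : ‖M (1 / spectralPoint ϱ ξ)‖ ≤ C :=
  hC _ (inv_mem_ball hr (by rwa [spectralPoint_re]))

theorem coeFn_multiplier {m : ℝ → H →L[ℂ] H} (hm : Continuous m) {C : ℝ} (hC : ∀ ξ, ‖m ξ‖ ≤ C)
    (g : LTwo H) : multiplier m g =ᵐ[volume] fun ξ => m ξ (g ξ) := by
  rw [multiplier, dif_pos (memLp_multiplier hm hC g)]
  exact MemLp.coeFn_toLp _

theorem multiplier_sub {m : ℝ → H →L[ℂ] H} (hm : Continuous m) {C : ℝ} (hC : ∀ ξ, ‖m ξ‖ ≤ C)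
    (f g : LTwo H) : multiplier m (f - g) = multiplier m f - multiplier m g := by
  refine Lp.ext ?_
  filter_upwards [coeFn_multiplier hm hC f, coeFn_multiplier hm hC g,
    coeFn_multiplier hm hC (f - g), Lp.coeFn_sub f g,
    Lp.coeFn_sub (multiplier m f) (multiplier m g)] with x h1 h2 h3 h4 h5
  rw [h3, h5, h4, Pi.sub_apply, Pi.sub_apply, h1, h2, map_sub]

theorem norm_multiplier_le {m : ℝ → H →L[ℂ] H} (hm : Continuous m) {C : ℝ} (hC : ∀ ξ, ‖m ξ‖ ≤ C)
    (g : LTwo H) : ‖multiplier m g‖ ≤ C * ‖g‖ := by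
  refine Lp.norm_le_mul_norm_of_ae_le_mul ?_
  filter_upwards [coeFn_multiplier hm hC g] with x hx
  rw [hx]
  exact (m x).le_of_opNorm_le (hC x) _

theorem lipschitzWith_funcCalc (hr : 0 < r) (hM : AnalyticOnNhd ℂ M (Metric.ball (r : ℂ) r))
    {C : ℝ≥0} (hC : ∀ z ∈ Metric.ball (r : ℂ) r, ‖M z‖ ≤ C) {ϱ : ℝ} (hϱ : 1 / (2 * r) < ϱ) :
    LipschitzWith C (funcCalc ϱ M) := by
  have hm := continuous_symbol hr hM hϱ
  have hmC := norm_symbol_le hr hC hϱ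
  have hL : LipschitzWith C (multiplier fun ξ => M (1 / spectralPoint ϱ ξ)) :=
    LipschitzWith.of_dist_le_mul fun f g => by
      rw [dist_eq_norm, dist_eq_norm, ← multiplier_sub hm hmC]
      exact norm_multiplier_le hm hmC _
  have h := (expMul ϱ H).symm.lipschitz.comp ((Lp.fourierTransformₗᵢ ℝ H).symm.lipschitz.comp
    (hL.comp ((Lp.fourierTransformₗᵢ ℝ H).lipschitz.comp (expMul ϱ H).lipschitz)))
  simp only [one_mul, mul_one] at h
  exact h

/-! ### Independence of the weight -/

/-- The Fourier transform of `exp (-ϱ x) f x` consists of the values of the Laplace transform of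
`f` on the vertical line through `ϱ`. -/
theorem fourier_exp_smul (f : ℝ → H) (ϱ ξ : ℝ) :
    𝓕 (fun x => Real.exp (-ϱ * x) • f x) ξ = laplace f (spectralPoint ϱ ξ) := by
  rw [Real.fourier_eq', laplace]
  refine integral_congr_ae (ae_of_all _ fun x => ?_)
  simp only
  rw [← Complex.coe_smul (Real.exp _), smul_smul, Complex.ofReal_exp, ← Complex.exp_add]
  congr 2
  simp [spectralPoint]
  ring

theorem fourier_expMul_test (ϱ : ℝ) (φ : Test H) :
    (𝓕 (expMul ϱ H (Test.toHZero ϱ φ)) : LTwo H) =ᵐ[volume]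
      fun ξ => laplace (φ : ℝ → H) (spectralPoint ϱ ξ) := by
  have hc : HasCompactSupport fun x => Real.exp (-ϱ * x) • (φ : ℝ → H) x := φ.2.2.smul_left
  have hs : ContDiff ℝ ∞ fun x => Real.exp (-ϱ * x) • (φ : ℝ → H) x :=
    (by fun_prop : ContDiff ℝ ∞ fun x : ℝ => Real.exp (-ϱ * x)).smul φ.2.1
  have h1 : expMul ϱ H (Test.toHZero ϱ φ) = (hc.toSchwartzMap hs).toLp 2 := by
    refine Lp.ext ?_
    filter_upwards [expMul_coe ϱ (Test.toHZero ϱ φ), Test.coeFn_toHZero ϱ φ,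
      (hc.toSchwartzMap hs).coeFn_toLp 2 volume] with x e1 e2 e3
    rw [e1, e2, e3]
    rfl
  rw [h1, SchwartzMap.toLp_fourier_eq]
  filter_upwards [(𝓕 (hc.toSchwartzMap hs)).coeFn_toLp 2 volume] with ξ hξ
  rw [hξ, SchwartzMap.fourier_coe]
  exact fourier_exp_smul (φ : ℝ → H) ϱ ξ

/-- The holomorphic function whose integral along the vertical line through `ϱ` is the pairing of
`M(∂_{0,ϱ}⁻¹) φ` with `χ • v`, up to complex conjugation. -/
def pairingIntegrand (M : ℂ → H →L[ℂ] H) (φ : Test H) (χ : ℝ → ℝ) (v : H) (z : ℂ) : ℂ :=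
  laplace (fun x => (χ x : ℂ)) (-z) * inner ℂ v (M (1 / z) (laplace (φ : ℝ → H) z))

theorem laplace_smul_const (χ : ℝ → ℝ) (v : H) (z : ℂ) :
    laplace (fun x => χ x • v) z = laplace (fun x => (χ x : ℂ)) z • v := by
  rw [laplace, laplace, ← integral_smul_const]
  refine integral_congr_ae (ae_of_all _ fun x => ?_)
  simp only [smul_eq_mul, mul_smul, Complex.coe_smul]

/-- Plancherel's identity for the pairing of `M(∂_{0,ϱ}⁻¹) φ` with a test function. -/
theorem integral_inner_funcCalc (hr : 0 < r) (hM : AnalyticOnNhd ℂ M (Metric.ball (r : ℂ) r))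
    {C : ℝ} (hC : ∀ z ∈ Metric.ball (r : ℂ) r, ‖M z‖ ≤ C) {ϱ : ℝ} (hϱ : 1 / (2 * r) < ϱ)
    (φ : Test H) {χ : ℝ → ℝ} (hχ : ContDiff ℝ ∞ χ) (hc : HasCompactSupport χ) (v : H) :
    ∫ x, inner ℂ (funcCalc ϱ M (Test.toHZero ϱ φ) x) (χ x • v)
      = (starRingEnd ℂ) (∫ ξ, pairingIntegrand M φ χ v (spectralPoint ϱ ξ)) := by
  let η : Test H := ⟨fun x => χ x • v, hχ.smul contDiff_const, hc.smul_right⟩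
  set A : LTwo H := multiplier (fun ξ => M (1 / spectralPoint ϱ ξ))
    (𝓕 (expMul ϱ H (Test.toHZero ϱ φ))) with hA
  have h1 : ∫ x, inner ℂ (funcCalc ϱ M (Test.toHZero ϱ φ) x) (χ x • v)
      = pairing ϱ (funcCalc ϱ M (Test.toHZero ϱ φ)) (Test.toHZero (-ϱ) η) := by
    rw [pairing_apply]
    refine integral_congr_ae ?_
    filter_upwards [Test.coeFn_toHZero (-ϱ) η] with x hx
    rw [hx]
  have h2 : pairing ϱ (funcCalc ϱ M (Test.toHZero ϱ φ)) (Test.toHZero (-ϱ) η)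
      = inner ℂ A (𝓕 (expMul (-ϱ) H (Test.toHZero (-ϱ) η))) := by
    change inner ℂ (expMul ϱ H ((expMul ϱ H).symm (𝓕⁻ A))) _ = _
    rw [LinearIsometryEquiv.apply_symm_apply, ← Lp.inner_fourier_eq, fourier_fourierInv_eq]
    rfl
  rw [h1, h2, L2.inner_def, ← integral_conj]
  refine integral_congr_ae ?_
  filter_upwards [fourier_expMul_test ϱ φ, fourier_expMul_test (-ϱ) η,
    coeFn_multiplier (continuous_symbol hr hM hϱ) (norm_symbol_le hr hC hϱ)
      (𝓕 (expMul ϱ H (Test.toHZero ϱ φ)))] with ξ e1 e2 e3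
  have h3 : spectralPoint (-ϱ) ξ = (starRingEnd ℂ) (-spectralPoint ϱ ξ) := by
    apply Complex.ext <;> simp [spectralPoint]
  rw [hA, e3, e1, e2, pairingIntegrand, map_mul, conj_laplace, inner_conj_symm, ← h3]
  change inner ℂ _ (laplace (fun x => χ x • v) _) = _
  rw [laplace_smul_const, inner_smul_right]

theorem integral_pairingIntegrand_eq (hr : 0 < r)
    (hM : AnalyticOnNhd ℂ M (Metric.ball (r : ℂ) r)) {C : ℝ}
    (hC : ∀ z ∈ Metric.ball (r : ℂ) r, ‖M z‖ ≤ C) {ϱ ν : ℝ} (hϱ : 1 / (2 * r) < ϱ) (hν : ϱ ≤ ν)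
    (φ : Test H) {χ : ℝ → ℝ} (hχ : ContDiff ℝ ∞ χ) (hc : HasCompactSupport χ) (v : H) :
    ∫ ξ, pairingIntegrand M φ χ v (spectralPoint ϱ ξ)
      = ∫ ξ, pairingIntegrand M φ χ v (spectralPoint ν ξ) := by
  have h0 : 0 < ϱ := lt_trans (by positivity) hϱ
  have hχ' : ContDiff ℝ ∞ fun x => (χ x : ℂ) := Complex.ofRealCLM.contDiff.comp hχ
  have hc' : HasCompactSupport fun x => (χ x : ℂ) := hc.comp_left Complex.ofReal_zero
  obtain ⟨B₁, hB₁0, hB₁⟩ := norm_laplace_mul_le φ.2.1 φ.2.2 ν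
  obtain ⟨B₂, hB₂0, hB₂⟩ := norm_laplace_mul_le hχ' hc' ν
  have hC0 : 0 ≤ C := (norm_nonneg _).trans (hC r (Metric.mem_ball_self hr))
  -- on `Re z ≥ ϱ` one has `‖z‖² ≥ ϱ² + (Im z)² ≥ m (1 + (Im z)²)`
  set m := min 1 (ϱ ^ 2) with hm
  have hm0 : 0 < m := by positivity
  have hline : ∀ μ : ℝ, ∫ ξ, pairingIntegrand M φ χ v (spectralPoint μ ξ)
      = |(2 * Real.pi)⁻¹| • ∫ t : ℝ, pairingIntegrand M φ χ v (μ + t * Complex.I) := by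
    intro μ
    rw [← Measure.integral_comp_mul_left]
    refine integral_congr_ae (ae_of_all _ fun ξ => ?_)
    simp only [spectralPoint]
    rw [add_comm, mul_comm Complex.I]
  rw [hline, hline]
  congr 1
  refine integral_vertical_line_eq (K := B₂ * ‖v‖ * C * B₁ / m) hν (fun z h1 _ => ?_)
    fun z h1 h2 => ?_
  · have d1 : DifferentiableAt ℂ (fun z => laplace (fun x => (χ x : ℂ)) (-z)) z :=
      DifferentiableAt.comp z (g := laplace fun x => (χ x : ℂ))
        (differentiableAt_laplace hχ'.continuous hc' (-z)) differentiableAt_id.neg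
    have d2 := (differentiableAt_comp_inv hr hM (hϱ.trans_le h1)).clm_apply
      (differentiableAt_laplace φ.2.1.continuous φ.2.2 z)
    exact d1.mul ((innerSL ℂ v).differentiableAt.comp z d2)
  · have hz0 : z ≠ 0 := fun h => by rw [h, Complex.zero_re] at h1; linarith
    have hzn := norm_pos_iff.2 hz0
    have hre : |z.re| ≤ ν := abs_le.2 ⟨by linarith, h2⟩
    have b1 : ‖laplace (φ : ℝ → H) z‖ ≤ B₁ / ‖z‖ := by
      rw [le_div_iff₀' hzn]
      exact hB₁ z hre
    have b2 : ‖laplace (fun x => (χ x : ℂ)) (-z)‖ ≤ B₂ / ‖z‖ := by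
      rw [le_div_iff₀' hzn]
      simpa using hB₂ (-z) (by simpa using hre)
    have b3 := hC _ (inv_mem_ball hr (hϱ.trans_le h1))
    have b4 : m * (1 + z.im ^ 2) ≤ ‖z‖ ^ 2 := by
      rw [← Complex.normSq_eq_norm_sq, Complex.normSq_apply]
      have m1 : m ≤ 1 := min_le_left _ _
      have m2 : m ≤ ϱ ^ 2 := min_le_right _ _
      nlinarith [sq_nonneg z.im]
    calc ‖pairingIntegrand M φ χ v z‖
        ≤ ‖laplace (fun x => (χ x : ℂ)) (-z)‖
          * (‖v‖ * (‖M (1 / z)‖ * ‖laplace (φ : ℝ → H) z‖)) := by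
          rw [pairingIntegrand, norm_mul]
          gcongr
          exact (norm_inner_le_norm _ _).trans
            (mul_le_mul_of_nonneg_left ((M (1 / z)).le_opNorm _) (norm_nonneg _))
      _ ≤ B₂ / ‖z‖ * (‖v‖ * (C * (B₁ / ‖z‖))) := by gcongr
      _ = B₂ * ‖v‖ * C * B₁ * (‖z‖ ^ 2)⁻¹ := by field_simp
      _ ≤ B₂ * ‖v‖ * C * B₁ * (m * (1 + z.im ^ 2))⁻¹ := by gcongr
      _ = _ := by rw [mul_inv, div_eq_mul_inv]; ring

/-- For bounded analytic `M`, the operator `M(∂_{0,ϱ}⁻¹)` is causal. -/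
theorem isCausal_funcCalc (hr : 0 < r) (hM : AnalyticOnNhd ℂ M (Metric.ball (r : ℂ) r))
    {C : ℝ≥0} (hC : ∀ z ∈ Metric.ball (r : ℂ) r, ‖M z‖ ≤ C) {ϱ : ℝ} (hϱ : 1 / (2 * r) < ϱ) :
    IsCausal (funcCalc ϱ M) := by
  refine isCausal_of_uniform_lipschitz (fun ν => funcCalc ν M)
    (fun ν hν => lipschitzWith_funcCalc hr hM hC (hϱ.trans_le hν)) fun ν hν φ => ?_
  refine ae_eq_of_integral_inner_test ν ϱ _ _ fun χ v hχ hc => ?_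
  rw [integral_inner_funcCalc hr hM hC (hϱ.trans_le hν) φ hχ hc v,
    integral_inner_funcCalc hr hM hC hϱ φ hχ hc v,
    integral_pairingIntegrand_eq hr hM hC hϱ hν φ hχ hc v]

/-! ### Contraction and uniqueness up to a given time -/

/-- For a causal contraction `T`, a point that is fixed before time `a` coincides with every
fixed point before time `a`. -/
theorem agreeBefore_of_isCausal {ϱ : ℝ} {T : HZero ϱ H → HZero ϱ H} {q : ℝ≥0} (hq : q < 1)
    (hT : LipschitzWith q T) (hc : IsCausal T) {a : ℝ} {u v : HZero ϱ H} (hu : u = T u)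
    (hv : AgreeBefore a v (T v)) : AgreeBefore a u v := by
  -- `w` is `v` before `a` and `u` afterwards
  set w := u + truncate a (v - u) with hw
  have hwv : AgreeBefore a w v := by
    filter_upwards [coeFn_truncate a (v - u), coeFn_sub ϱ v u,
      (ac_expMeasure ϱ).ae_le (Lp.coeFn_add u (truncate a (v - u)))] with t h1 h2 h3 ht
    rw [hw, h3, Pi.add_apply, h1, Set.indicator_of_mem (Set.mem_Iio.2 ht), h2, add_sub_cancel]
  have h1 : truncate a v = truncate a (T w) := by
    rw [truncate_eq_iff]
    filter_upwards [hv, hc a w v hwv] with t e1 e2 ht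
    rw [e1 ht, e2 ht]
  have h2 : w - u = truncate a (T w - T u) := by
    rw [truncate_sub, ← h1, ← hu, ← truncate_sub, hw, add_sub_cancel_left]
  have h3 : dist w u ≤ q * dist w u := by
    calc dist w u = ‖truncate a (T w - T u)‖ := by rw [dist_eq_norm, h2]
      _ ≤ dist (T w) (T u) := by rw [dist_eq_norm]; exact norm_truncate_le a _
      _ ≤ _ := hT.dist_le_mul w u
  have h4 : dist w u ≤ 0 := by
    have : (q : ℝ) < 1 := hq
    nlinarith [dist_nonneg (x := w) (y := u)]
  rw [dist_le_zero] at h4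
  rwa [h4] at hwv

/-! ### Solution theory -/

/-- If the product of a Lipschitz constant with finite numbers `m`, `n` is less than one for the
best Lipschitz constant, then it is so for some Lipschitz constant. -/
theorem exists_lipschitzWith_mul_lt_one {X Y : Type*} [PseudoEMetricSpace X] [PseudoEMetricSpace Y]
    {G : X → Y} {s : ℝ≥0} (hs : LipschitzWith s G) {m : ℝ≥0} (h : lipConst G * m < 1) :
    ∃ K : ℝ≥0, LipschitzWith K G ∧ K * m < 1 := by
  -- for `m = 0` the best constant carries no information, as `∞ * 0 = 0`
  rcases eq_or_ne m 0 with rfl | hm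
  · exact ⟨s, hs, by simp⟩
  have hm' : (m : ℝ≥0∞) ≠ 0 := by simpa using hm
  rw [← ENNReal.lt_div_iff_mul_lt (Or.inl hm') (Or.inl ENNReal.coe_ne_top), lipConst] at h
  simp only [iInf_lt_iff] at h
  obtain ⟨K, hK, h⟩ := h
  rw [ENNReal.lt_div_iff_mul_lt (Or.inl hm') (Or.inl ENNReal.coe_ne_top)] at h
  exact ⟨K, hK, by exact_mod_cast h⟩

/-- The supremum of the norms of a bounded operator-valued function, as a nonnegative real. -/
theorem exists_iSup_enorm_eq {E : Type*} [NormedAddCommGroup E] {M : ℂ → E} {U : Set ℂ}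
    (hM : ∃ C : ℝ, ∀ z ∈ U, ‖M z‖ ≤ C) :
    ∃ C : ℝ≥0, ⨆ z ∈ U, ‖M z‖ₑ = C ∧ ∀ z ∈ U, ‖M z‖ ≤ C := by
  obtain ⟨C, hC⟩ := hM
  have h : ⨆ z ∈ U, ‖M z‖ₑ ≠ ⊤ := by
    refine ne_top_of_le_ne_top (ENNReal.coe_ne_top (r := C.toNNReal)) (iSup₂_le fun z hz => ?_)
    rw [← ofReal_norm]
    exact ENNReal.ofReal_le_ofReal (hC z hz)
  refine ⟨(⨆ z ∈ U, ‖M z‖ₑ).toNNReal, (ENNReal.coe_toNNReal h).symm, fun z hz => ?_⟩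
  have h1 : ‖M z‖ₑ ≤ ((⨆ z ∈ U, ‖M z‖ₑ).toNNReal : ℝ≥0∞) := by
    rw [ENNReal.coe_toNNReal h]
    exact le_iSup₂ (f := fun z (_ : z ∈ U) => ‖M z‖ₑ) z hz
  rw [enorm_eq_nnnorm] at h1
  exact_mod_cast h1

end EvoDelay

end

theorem theorem5p14 {H : Type*} [NormedAddCommGroup H] [InnerProductSpace ℂ H] [CompleteSpace H]
    (r : ℝ) (hr : 0 < r) (M N : ℂ → H →L[ℂ] H)
    (hM : AnalyticOnNhd ℂ M (Metric.ball (r : ℂ) r))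
    (hMb : ∃ C : ℝ, ∀ z ∈ Metric.ball (r : ℂ) r, ‖M z‖ ≤ C)
    (hN : AnalyticOnNhd ℂ N (Metric.ball (r : ℂ) r))
    (hNb : ∃ C : ℝ, ∀ z ∈ Metric.ball (r : ℂ) r, ‖N z‖ ≤ C)
    (ϱ₀ s : ℝ) (hϱ₀ : 0 < ϱ₀) (hs : s ∈ Set.Ioo (0 : ℝ) 1)
    (F : EvoDelay.Test H → (EvoDelay.TestPlus H →ₗ[ℂ] ℂ))
    (hF : EvoDelay.PicardLindelofCondition ϱ₀ s F)
    (hlip : limsup (fun ϱ : ℝ => EvoDelay.lipConst (EvoDelay.lipExtension F ϱ)) atTop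
      * (⨆ z ∈ Metric.ball (r : ℂ) r, ‖M z‖ₑ) * (⨆ z ∈ Metric.ball (r : ℂ) r, ‖N z‖ₑ) < 1) :
    (∀ ϱ : ℝ, ϱ₀ < ϱ → EvoDelay.IsLipschitzExtension F ϱ (EvoDelay.lipExtension F ϱ) ∧
      ∀ G, EvoDelay.IsLipschitzExtension F ϱ G → G = EvoDelay.lipExtension F ϱ) ∧
    ∃ ϱ₁ : ℝ, max ϱ₀ (1 / (2 * r)) < ϱ₁ ∧ ∀ ϱ : ℝ, ϱ₁ < ϱ →
      (∃! u : EvoDelay.HZero ϱ H,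
        EvoDelay.timeDeriv ϱ u = EvoDelay.rightHandSide M N F ϱ u) ∧
      EvoDelay.IsCausal
        (fun x => EvoDelay.timeDerivInv ϱ (EvoDelay.rightHandSide M N F ϱ x)) ∧
      ∀ (G : EvoDelay.HZero ϱ H → EvoDelay.HNeg ϱ H) (a : ℝ),
        (∀ x : EvoDelay.HZero ϱ H, EvoDelay.AgreeBefore a
          (EvoDelay.timeDerivInv ϱ (EvoDelay.rightHandSide M N F ϱ x))
          (EvoDelay.timeDerivInv ϱ (G x))) →
        ∀ u v : EvoDelay.HZero ϱ H,
          EvoDelay.timeDeriv ϱ u = EvoDelay.rightHandSide M N F ϱ u →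
          EvoDelay.timeDeriv ϱ v = G v → EvoDelay.AgreeBefore a u v := by
  open EvoDelay in
  refine ⟨fun ϱ hϱ => ?_, ?_⟩
  · have h := isLipschitzExtension_lipExtension hϱ₀ hs.1.le hF hϱ
    exact ⟨h, fun G hG => hG.unique (hϱ₀.trans hϱ) h⟩
  obtain ⟨m, hm, hmM⟩ := exists_iSup_enorm_eq hMb
  obtain ⟨n, hn, hnN⟩ := exists_iSup_enorm_eq hNb
  rw [hm, hn, mul_assoc, ← ENNReal.coe_mul] at hlip
  -- for large weights the product bound holds with the best Lipschitz constant itself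
  have hev : ∀ᶠ ϱ in atTop, lipConst (lipExtension F ϱ) * ((m * n : ℝ≥0) : ℝ≥0∞) < 1 := by
    rcases eq_or_ne (m * n) 0 with h0 | h0
    · simp [h0]
    · have h1 : ((m * n : ℝ≥0) : ℝ≥0∞) ≠ 0 := by exact_mod_cast h0
      rw [← ENNReal.lt_div_iff_mul_lt (Or.inl h1) (Or.inl ENNReal.coe_ne_top)] at hlip
      filter_upwards [eventually_lt_of_limsup_lt hlip] with ϱ hϱ
      rwa [ENNReal.lt_div_iff_mul_lt (Or.inl h1) (Or.inl ENNReal.coe_ne_top)] at hϱ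
  obtain ⟨b, hb⟩ := eventually_atTop.1 hev
  refine ⟨max b (max ϱ₀ (1 / (2 * r)) + 1), (lt_add_one _).trans_le (le_max_right _ _),
    fun ϱ hϱ => ?_⟩
  obtain ⟨hbϱ, hϱ'⟩ := max_lt_iff.1 hϱ
  obtain ⟨h0, h1⟩ := max_lt_iff.1 ((lt_add_one _).trans hϱ')
  have hpos := hϱ₀.trans h0
  obtain ⟨K, hK, hK1⟩ := exists_lipschitzWith_mul_lt_one
    (lipschitzWith_lipExtension hϱ₀ hs.1.le hF h0) (hb ϱ hbϱ.le)
  set T : HZero ϱ H → HZero ϱ H := fun x => timeDerivInv ϱ (rightHandSide M N F ϱ x) with hTdef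
  have hTeq : T = funcCalc ϱ M ∘ (fun x => timeDerivInv ϱ (lipExtension F ϱ x)) ∘
      funcCalc ϱ N := funext fun x => timeDerivInv_timeDeriv hpos _
  have hTc : IsCausal T := by
    rw [hTeq]
    exact (isCausal_funcCalc hr hM hmM h1).comp
      ((isCausal_timeDerivInv_lipExtension hϱ₀ hs.1.le hF h0).comp (isCausal_funcCalc hr hN hnN h1))
  have hTL : LipschitzWith (K * (m * n)) T := by
    rw [hTeq]
    refine ((lipschitzWith_funcCalc hr hM hmM h1).comp
      (((isometry_timeDerivInv hpos).lipschitz.comp hK).comp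
        (lipschitzWith_funcCalc hr hN hnN h1))).weaken (le_of_eq ?_)
    ring
  have hsol : ∀ u : HZero ϱ H, timeDeriv ϱ u = rightHandSide M N F ϱ u ↔ T u = u := by
    intro u
    rw [← (timeDeriv_injective hpos).eq_iff (a := T u), hTdef, timeDeriv_timeDerivInv, eq_comm]
  have hT : ContractingWith (K * (m * n)) T := ⟨hK1, hTL⟩
  refine ⟨⟨hT.fixedPoint, (hsol _).2 hT.fixedPoint_isFixedPt, fun u hu =>
    hT.fixedPoint_unique ((hsol u).1 hu)⟩, hTc, fun G a hG u v hu hv => ?_⟩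
  refine agreeBefore_of_isCausal hK1 hTL hTc ((hsol u).1 hu).symm ?_
  have hvG : timeDerivInv ϱ (G v) = v := by rw [← hv, timeDerivInv_timeDeriv hpos]
  filter_upwards [hG v] with t ht hta
  rw [ht hta, hvG]
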